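/- Quivers are finite (loops and multiple edges allowed) and connected (in particular nonempty); the genus of a quiver is the first Betti number of its geometric realization, and a directed tree is a connected quiver of genus $0$. A minor morphism $\phi\colon Q'\to Q$ of quivers is a map of sets $V(Q')\sqcup E(Q')\sqcup\{\star\}\to V(Q)\sqcup E(Q)\sqcup\{\star\}$ such that $\phi(V(Q'))=V(Q)$ and $\phi(\star)=\star$; for each edge $e$ of $Q'$ with $\phi(e)\neq\star$, either $\phi(e)=\phi(s(e))=\phi(t(e))$ is a vertex of $Q$, or $\phi(e)$ is an edge of $Q$ with source $\phi(s(e))$ and target $\phi(t(e))$; $\phi$ restricts to a bijection $\phi^{-1}(E(Q))\to E(Q)$; and for each vertex $v$ of $Q$ the subquiver $\phi^{-1}(v)$ of $Q'$ is a directed tree. Edges sent to $\star$ are called deleted, edges sent to vertices are called contracted. A directed cone over a quiver $G$ (its base) is a quiver obtained from $G$ by adding one new vertex, the cone point, and, for every vertex $x$ of $G$, exactly one edge (cone edge) between $x$ and the cone point, in one of the two directions. A base contraction between directed cones is a minor morphism that sends the cone point to the cone point and base vertices to base vertices, sends every base edge to a base vertex (contraction) or to a base edge, and deletes every cone edge or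 sends it to a cone edge (so that, of the cone edges that become parallel, all but one are deleted). A base deletion is a minor morphism that sends the cone point to the cone point and base vertices to base vertices, deletes every base edge or sends it to a base edge, and sends every cone edge to a cone edge. A base minor morphism is a composition of base contractions and base deletions. For an integer $g\ge 0$ let $\mathfrak{Cone}(\mathbf{Quiver}_{\le g})$ be the category whose objects are the directed cones over quivers of genus at most $g$ and whose morphisms are the base minor morphisms. An essentially small category $\mathbf C$ is Gröbner if for every object $c$ the functor $S_c=\mathrm{Hom}_{\mathbf C}(c,-)$ satisfies: (i) the sets $S_c(c')$ can be well-ordered so that all induced maps $S_c(c')\to S_c(c'')$ are strictly order-preserving; (ii) the poset $|S_c|$, obtained from $\bigsqcup_{c'}S_c(c')$ with the preorder $f\le f'$ iff $f'=h_*f$ for some morphism $h$ by identifying $f,f'$ whenever $f\le f'\le f$, is Noetherian, i.e. every infinite sequence $x_1,x_2,\dots$ in it has indices $i<j$ with $x_i\le x_j$. A functor $F\colon\mathbf C\to\mathbf D$ has property (F) if for every object $d$ of $\mathbf D$ there are finitely many objects $c_1,\dots,c_n$ of $\mathbf C$ and morphisms $\delta_i\colon d\to F(c_i)$ such that every morphism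 $\delta\colon d\to F(c)$ equals $F(\gamma)\circ\delta_i$ for some $i$ and some $\gamma\colon c_i\to c$. An essentially small category is quasi-Gröbner if it receives an essentially surjective functor with property (F) from a Gröbner category. A representation of $\mathbf C$ over a ring $A$ is a functor $M$ from $\mathbf C$ to left $A$-modules; it is finitely generated if there is a finite set $S\subseteq\bigoplus_{c}M(c)$ such that the smallest subrepresentation $N$ of $M$ with $S\subseteq\bigoplus_c N(c)$ is $M$ itself. **Proposition.** For every integer $g\ge 0$ the category $\mathfrak{Cone}(\mathbf{Quiver}_{\le g})^{\mathrm{op}}$ is quasi-Gröbner. Moreover, for every left Noetherian ring $A$, every subrepresentation of a finitely generated representation of $\mathfrak{Cone}(\mathbf{Quiver}_{\le g})^{\mathrm{op}}$ over $A$ is finitely generated. -/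

import Mathlib

open CategoryTheory

universe a b u v u' v'

/-! ## Representations of categories -/

section Representations

variable {C : Type u} [Category.{v} C] {A : Type a} [Ring A]

/-- A submodule of the representation `M : C ⥤ ModuleCat A`. -/
@[ext]
structure Subrep (M : C ⥤ ModuleCat.{b} A) where
  /-- the submodule `N(c) ⊆ M(c)` -/
  obj : ∀ c : C, Submodule A (M.obj c)
  map_mem : ∀ {c d : C} (h : c ⟶ d) (x : M.obj c), x ∈ obj c → (M.map h).hom x ∈ obj d

/-- A submodule of a representation, as a representation. -/
def Subrep.toRep {M : C ⥤ ModuleCat.{b} A} (N : Subrep M) : C ⥤ ModuleCat.{b} A where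
  obj c := ModuleCat.of A (N.obj c)
  map {c d} h := ModuleCat.ofHom ((M.map h).hom.restrict (N.map_mem h))
  map_id c := by
    ext x
    simp [LinearMap.restrict_apply]
  map_comp h k := by
    ext x
    simp [LinearMap.restrict_apply]

open DirectSum in
/-- The span of `S ⊆ ⨁ c, M(c)`: the smallest submodule `N` of `M` with `S ⊆ ⨁ c, N(c)`. -/
def Subrep.span (M : C ⥤ ModuleCat.{b} A) (S : Set (⨁ c : C, M.obj c)) : Subrep M where
  obj c := sInf {P | ∃ N : Subrep M, (∀ s ∈ S, ∀ d, s d ∈ N.obj d) ∧ P = N.obj c}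
  map_mem := by
    intro c d h x hx
    rw [Submodule.mem_sInf] at hx ⊢
    rintro P ⟨N, hN, rfl⟩
    exact N.map_mem h x (hx _ ⟨N, hN, rfl⟩)

open DirectSum in
/-- A representation is finitely generated if it is the span of a finite set. -/
def IsFinGenRep (M : C ⥤ ModuleCat.{b} A) : Prop :=
  ∃ S : Set (⨁ c : C, M.obj c), S.Finite ∧ ∀ c, (Subrep.span M S).obj c = ⊤

end Representations

/-! ## Gröbner and quasi-Gröbner categories -/

section Grobner

/-- The disjoint union of the sets `S(c)`. -/
def TotalSet {C : Type u} [Category.{v} C] (S : C ⥤ Type v') : Type (max u v') :=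
  Σ c : C, S.obj c

/-- `f ≤ g` if `g = h_* f` for some morphism `h`. -/
instance {C : Type u} [Category.{v} C] (S : C ⥤ Type v') : Preorder (TotalSet S) where
  le f g := ∃ h : f.1 ⟶ g.1, S.map h f.2 = g.2
  le_refl f := ⟨𝟙 _, by simp⟩
  le_trans f g k := by
    rintro ⟨h, hh⟩ ⟨h', hh'⟩
    exact ⟨h ≫ h', by simp [hh, hh']⟩

/-- The poset `|S|` associated with a functor `S` to sets. -/
abbrev AssocPoset {C : Type u} [Category.{v} C] (S : C ⥤ Type v') : Type (max u v') :=
  Antisymmetrization (TotalSet S) (· ≤ ·)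

/-- `S` is orderable: each `S(c)` can be given a well-order (with strict part `r c`), such that
all induced maps are strictly order-preserving. -/
def IsOrderable {C : Type u} [Category.{v} C] (S : C ⥤ Type v') : Prop :=
  ∃ r : ∀ c : C, S.obj c → S.obj c → Prop,
    (∀ c, IsWellOrder (S.obj c) (r c)) ∧
    ∀ (c d : C) (h : c ⟶ d) (x y : S.obj c), r c x y → r d (S.map h x) (S.map h y)

/-- Gröbner categories. A poset is Noetherian if every infinite sequence `x` in it has indices
`i < j` with `x i ≤ x j`; this is Mathlib's `WellQuasiOrderedLE`. -/
def IsGrobner (C : Type u) [Category.{v} C] : Prop :=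
  EssentiallySmall.{v} C ∧
  ∀ c : C, IsOrderable (coyoneda.obj (Opposite.op c)) ∧
    WellQuasiOrderedLE (AssocPoset (coyoneda.obj (Opposite.op c)))

/-- Property (F) of a functor. -/
def HasPropertyF {C : Type u} [Category.{v} C] {D : Type u'} [Category.{v'} D]
    (F : C ⥤ D) : Prop :=
  ∀ d : D, ∃ (n : ℕ) (c : Fin n → C) (δ : ∀ i, d ⟶ F.obj (c i)),
    ∀ (c' : C) (δ' : d ⟶ F.obj c'), ∃ (i : Fin n) (γ : c i ⟶ c'), δ' = δ i ≫ F.map γ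

/-- Quasi-Gröbner categories. -/
def IsQuasiGrobner (C : Type u) [Category.{v} C] : Prop :=
  EssentiallySmall.{v} C ∧
  ∃ (D : Type u) (_ : Category.{v} D) (F : D ⥤ C),
    IsGrobner D ∧ F.EssSurj ∧ HasPropertyF F

end Grobner

/-! ## Finite quivers -/

/-- A finite quiver (finite directed multigraph, loops allowed). -/
structure FinQuiver where
  /-- vertices -/
  V : Type
  /-- edges -/
  E : Type
  /-- source -/
  s : E → V
  /-- target -/
  t : E → V
  finite_V : Finite V
  finite_E : Finite E

namespace FinQuiver

/-- The geometric realization is (nonempty and) connected: any two vertices are joined by a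
zigzag of edges. -/
def Connected (Q : FinQuiver) : Prop :=
  Nonempty Q.V ∧ ∀ x y : Q.V, Relation.EqvGen (fun p q => ∃ e : Q.E, Q.s e = p ∧ Q.t e = q) x y

/-- The boundary map of the cellular chain complex of the geometric realization, over `ℚ`. -/
noncomputable def boundary (Q : FinQuiver) : (Q.E →₀ ℚ) →ₗ[ℚ] (Q.V →₀ ℚ) :=
  Finsupp.linearCombination ℚ
    (fun e => Finsupp.single (Q.t e) (1 : ℚ) - Finsupp.single (Q.s e) (1 : ℚ))

/-- The genus: the first Betti number of the geometric realization. -/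
noncomputable def genus (Q : FinQuiver) : ℕ := Module.finrank ℚ (LinearMap.ker Q.boundary)

/-- A directed tree: a connected quiver of genus `0`. -/
def IsTree (Q : FinQuiver) : Prop := Q.Connected ∧ Q.genus = 0

/-- The subquiver with given sets of vertices and edges. -/
def sub (Q : FinQuiver) (X : Set Q.V) (Y : Set Q.E) (h : ∀ e ∈ Y, Q.s e ∈ X ∧ Q.t e ∈ X) :
    FinQuiver where
  V := X
  E := Y
  s e := ⟨Q.s e, (h e e.2).1⟩
  t e := ⟨Q.t e, (h e e.2).2⟩
  finite_V := by have := Q.finite_V; exact inferInstance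
  finite_E := by have := Q.finite_E; exact inferInstance

/-- The set `V ⊔ E ⊔ {⋆}`. -/
inductive Cell (Q : FinQuiver) : Type
  | vert (x : Q.V) : Cell Q
  | edge (e : Q.E) : Cell Q
  | star : Cell Q

open Cell

/-- The map of sets `φ : V(P) ⊔ E(P) ⊔ {⋆} → V(Q) ⊔ E(Q) ⊔ {⋆}` is a minor morphism. Edges sent
to `⋆` are deleted, edges sent to vertices are contracted. -/
structure IsMinor {P Q : FinQuiver} (φ : Cell P → Cell Q) : Prop where
  map_star : φ star = star
  image_vert : φ '' Set.range vert = Set.range vert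
  edge_vert : ∀ (e : P.E) (y : Q.V), φ (edge e) = vert y →
    φ (vert (P.s e)) = vert y ∧ φ (vert (P.t e)) = vert y
  edge_edge : ∀ (e : P.E) (e' : Q.E), φ (edge e) = edge e' →
    φ (vert (P.s e)) = vert (Q.s e') ∧ φ (vert (P.t e)) = vert (Q.t e')
  bijOn : Set.BijOn φ (φ ⁻¹' Set.range edge) (Set.range edge)
  tree : ∀ y : Q.V,
    (P.sub {x | φ (vert x) = vert y} {e | φ (edge e) = vert y} (fun e he => edge_vert e y he)).IsTree

/-! ### Minor morphisms compose -/

/-- Genus `0` means that every 1-cochain is a coboundary. -/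
theorem genus_eq_zero_iff (Q : FinQuiver) :
    Q.genus = 0 ↔ ∀ y : Q.E → ℚ, ∃ p : Q.V → ℚ, ∀ e, p (Q.t e) - p (Q.s e) = y e := by
  have := Q.finite_E
  have := Q.finite_V
  rw [genus, Submodule.finrank_eq_zero, LinearMap.ker_eq_bot, ← LinearMap.dualMap_surjective_iff]
  constructor
  · intro h y
    obtain ⟨p, hp⟩ := h (Finsupp.linearCombination ℚ y)
    refine ⟨fun x => p (Finsupp.single x 1), fun e => ?_⟩
    have := congrArg (fun l => l (Finsupp.single e 1)) hp
    simpa [boundary, LinearMap.dualMap_apply] using this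
  · intro h l
    obtain ⟨p, hp⟩ := h (fun e => l (Finsupp.single e 1))
    refine ⟨Finsupp.linearCombination ℚ p, ?_⟩
    ext e
    simpa [boundary, LinearMap.dualMap_apply] using hp e

theorem IsMinor.exists_vert {P Q : FinQuiver} {φ : Cell P → Cell Q} (h : IsMinor φ) (x : P.V) :
    ∃ y, φ (vert x) = vert y := by
  have : φ (vert x) ∈ Set.range (vert : Q.V → Cell Q) := by
    rw [← h.image_vert]; exact ⟨_, ⟨x, rfl⟩, rfl⟩
  obtain ⟨y, hy⟩ := this
  exact ⟨y, hy.symm⟩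

theorem IsMinor.surj_vert {P Q : FinQuiver} {φ : Cell P → Cell Q} (h : IsMinor φ) (y : Q.V) :
    ∃ x, φ (vert x) = vert y := by
  have : vert y ∈ φ '' Set.range vert := by rw [h.image_vert]; exact ⟨y, rfl⟩
  obtain ⟨_, ⟨x, rfl⟩, hx⟩ := this
  exact ⟨x, hx⟩

theorem IsMinor.surj_edge {P Q : FinQuiver} {φ : Cell P → Cell Q} (h : IsMinor φ) (e : Q.E) :
    ∃ e', φ (edge e') = edge e := by
  obtain ⟨c, -, hc⟩ := h.bijOn.surjOn (⟨e, rfl⟩ : edge e ∈ Set.range edge)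
  cases c with
  | vert x => obtain ⟨y, hy⟩ := h.exists_vert x; rw [hy] at hc; cases hc
  | edge e' => exact ⟨e', hc⟩
  | star => rw [h.map_star] at hc; cases hc

theorem IsMinor.inj_edge {P Q : FinQuiver} {φ : Cell P → Cell Q} (h : IsMinor φ) {e₁ e₂ : P.E}
    {e : Q.E} (h₁ : φ (edge e₁) = edge e) (h₂ : φ (edge e₂) = edge e) : e₁ = e₂ := by
  have := h.bijOn.injOn (⟨e, h₁.symm⟩ : edge e₁ ∈ φ ⁻¹' Set.range edge)
    (⟨e, h₂.symm⟩ : edge e₂ ∈ φ ⁻¹' Set.range edge) (h₁.trans h₂.symm)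
  injection this

theorem isMinor_id (Q : FinQuiver) : IsMinor (id : Cell Q → Cell Q) where
  map_star := rfl
  image_vert := by simp
  edge_vert e y h := by cases h
  edge_edge e e' h := by cases h; exact ⟨rfl, rfl⟩
  bijOn := Set.bijOn_id _
  tree y := by
    refine ⟨⟨⟨⟨y, rfl⟩⟩, ?_⟩, ?_⟩
    · rintro ⟨x, hx⟩ ⟨x', hx'⟩
      cases hx; cases hx'
      exact Relation.EqvGen.refl _
    · rw [genus_eq_zero_iff]
      intro _
      refine ⟨fun _ => 0, ?_⟩
      rintro ⟨e, he⟩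
      cases he

theorem IsMinor.comp_edge_vert {P Q R : FinQuiver} {φ : Cell P → Cell Q} {ψ : Cell Q → Cell R}
    (hφ : IsMinor φ) (hψ : IsMinor ψ) (e : P.E) (y : R.V) (h : ψ (φ (edge e)) = vert y) :
    ψ (φ (vert (P.s e))) = vert y ∧ ψ (φ (vert (P.t e))) = vert y := by
  cases hc : φ (edge e) with
  | vert x =>
    rw [hc] at h
    rw [(hφ.edge_vert e x hc).1, (hφ.edge_vert e x hc).2]
    exact ⟨h, h⟩
  | edge e' =>
    rw [hc] at h
    rw [(hφ.edge_edge e e' hc).1, (hφ.edge_edge e e' hc).2]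
    exact hψ.edge_vert e' y h
  | star => rw [hc, hψ.map_star] at h; cases h

theorem IsMinor.comp_tree {P Q R : FinQuiver} {φ : Cell P → Cell Q} {ψ : Cell Q → Cell R}
    (hφ : IsMinor φ) (hψ : IsMinor ψ) (y : R.V) :
    (P.sub {x | (ψ ∘ φ) (vert x) = vert y} {e | (ψ ∘ φ) (edge e) = vert y}
      (fun e he => hφ.comp_edge_vert hψ e y he)).IsTree := by
  set F := P.sub {x | (ψ ∘ φ) (vert x) = vert y} {e | (ψ ∘ φ) (edge e) = vert y}
      (fun e he => hφ.comp_edge_vert hψ e y he) with hF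
  obtain ⟨⟨⟨z₀⟩, hconn⟩, hgen⟩ := hψ.tree y
  have key : ∀ z z' : {x | ψ (vert x) = vert y},
      Relation.EqvGen (fun p q => ∃ e : {e | ψ (edge e) = vert y},
        (⟨Q.s e, (hψ.edge_vert e y e.2).1⟩ : {x | ψ (vert x) = vert y}) = p ∧
        (⟨Q.t e, (hψ.edge_vert e y e.2).2⟩ : {x | ψ (vert x) = vert y}) = q) z z' →
      ∀ x x' : F.V, φ (vert x.1) = vert z.1 → φ (vert x'.1) = vert z'.1 →
      Relation.EqvGen (fun p q => ∃ e : F.E, F.s e = p ∧ F.t e = q) x x' := by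
    have fib : ∀ (z : Q.V) (hz : ψ (vert z) = vert y) (x x' : F.V), φ (vert x.1) = vert z →
        φ (vert x'.1) = vert z →
        Relation.EqvGen (fun p q => ∃ e : F.E, F.s e = p ∧ F.t e = q) x x' := by
      intro z hz x x' hx hx'
      have h := (hφ.tree z).1.2 ⟨x.1, hx⟩ ⟨x'.1, hx'⟩
      have gen : ∀ p q : {x | φ (vert x) = vert z},
          Relation.EqvGen (fun p q => ∃ e : {e | φ (edge e) = vert z},
            (⟨P.s e, (hφ.edge_vert e z e.2).1⟩ : {x | φ (vert x) = vert z}) = p ∧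
            (⟨P.t e, (hφ.edge_vert e z e.2).2⟩ : {x | φ (vert x) = vert z}) = q) p q →
          ∀ p' q' : F.V, p'.1 = p.1 → q'.1 = q.1 →
          Relation.EqvGen (fun p q => ∃ e : F.E, F.s e = p ∧ F.t e = q) p' q' := by
        intro p q hpq
        induction hpq with
        | rel p q hpq =>
          obtain ⟨e, rfl, rfl⟩ := hpq
          intro p' q' hp hq
          refine Relation.EqvGen.rel _ _ ⟨⟨e.1, ?_⟩, Subtype.ext hp.symm, Subtype.ext hq.symm⟩
          change ψ (φ (edge e.1)) = vert y
          rw [show φ (edge e.1) = vert z from e.2, hz]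
        | refl p =>
          intro p' q' hp hq
          rw [Subtype.ext (hp.trans hq.symm)]
          exact Relation.EqvGen.refl _
        | symm p q _ ih => intro p' q' hp hq; exact (ih q' p' hq hp).symm
        | trans p q r _ _ ih₁ ih₂ =>
          intro p' r' hp hr
          have hq : ψ (φ (vert q.1)) = vert y := by
            rw [show φ (vert q.1) = vert z from q.2, hz]
          exact (ih₁ p' ⟨q.1, hq⟩ hp rfl).trans _ _ _ (ih₂ ⟨q.1, hq⟩ r' rfl hr)
      exact gen _ _ h x x' rfl rfl
    intro z z' hzz
    induction hzz with
    | rel z z' hzz =>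
      obtain ⟨e, rfl, rfl⟩ := hzz
      intro x x' hx hx'
      obtain ⟨e', he'⟩ := hφ.surj_edge e.1
      have hs := hφ.edge_edge e' e.1 he'
      have he : ψ (φ (edge e')) = vert y := by rw [he']; exact e.2
      have h₁ := fib (Q.s e.1) (hψ.edge_vert e.1 y e.2).1 x (F.s ⟨e', he⟩) hx hs.1
      have h₂ := fib (Q.t e.1) (hψ.edge_vert e.1 y e.2).2 (F.t ⟨e', he⟩) x' hs.2 hx'
      exact (h₁.trans _ _ _ (Relation.EqvGen.rel _ _ ⟨⟨e', he⟩, rfl, rfl⟩)).trans _ _ _ h₂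
    | refl z => intro x x' hx hx'; exact fib z.1 z.2 x x' hx hx'
    | symm z z' _ ih => intro x x' hx hx'; exact (ih x' x hx' hx).symm
    | trans p q r _ _ ih₁ ih₂ =>
      intro x x' hx hx'
      obtain ⟨w, hw⟩ := hφ.surj_vert q.1
      have hw' : ψ (φ (vert w)) = vert y := by rw [hw]; exact q.2
      exact (ih₁ x ⟨w, hw'⟩ hx hw).trans _ _ _ (ih₂ ⟨w, hw'⟩ x' hw hx')
  refine ⟨⟨?_, ?_⟩, ?_⟩
  · obtain ⟨w, hw⟩ := hφ.surj_vert z₀.1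
    refine ⟨⟨w, ?_⟩⟩
    change ψ (φ (vert w)) = vert y
    rw [hw]; exact z₀.2
  · intro x x'
    obtain ⟨z, hz⟩ := hφ.exists_vert x.1
    obtain ⟨z', hz'⟩ := hφ.exists_vert x'.1
    have h₁ : ψ (vert z) = vert y := by rw [← hz]; exact x.2
    have h₂ : ψ (vert z') = vert y := by rw [← hz']; exact x'.2
    exact key ⟨z, h₁⟩ ⟨z', h₂⟩ (hconn ⟨z, h₁⟩ ⟨z', h₂⟩) x x' hz hz'
  · rw [genus_eq_zero_iff]
    intro c
    classical
    let c' : P.E → ℚ := fun e => if h : ψ (φ (edge e)) = vert y then c ⟨e, h⟩ else 0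
    have hp : ∀ z : Q.V, ∃ p : {x | φ (vert x) = vert z} → ℚ,
        ∀ e : {e | φ (edge e) = vert z}, p ⟨P.t e, (hφ.edge_vert e z e.2).2⟩ -
          p ⟨P.s e, (hφ.edge_vert e z e.2).1⟩ = c' e.1 :=
      fun z => (genus_eq_zero_iff _).1 (hφ.tree z).2 (fun e => c' e.1)
    choose p hp using hp
    choose f hf using hφ.exists_vert
    let p' : P.V → ℚ := fun x => p (f x) ⟨x, hf x⟩
    have hp' : ∀ (z : Q.V) (e : P.E), φ (edge e) = vert z → p' (P.t e) - p' (P.s e) = c' e := by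
      intro z e he
      have hx : ∀ x (hx : φ (vert x) = vert z), p' x = p z ⟨x, hx⟩ := by
        intro x hx
        have : f x = z := by have := (hf x).symm.trans hx; injection this
        subst this; rfl
      rw [hx _ (hφ.edge_vert e z he).2, hx _ (hφ.edge_vert e z he).1]
      exact hp z ⟨e, he⟩
    choose k hk using hφ.surj_edge
    obtain ⟨q, hq⟩ := (genus_eq_zero_iff _).1 hgen
      (fun e => c' (k e.1) - (p' (P.t (k e.1)) - p' (P.s (k e.1))))
    have hq' : ∀ e : {e | ψ (edge e) = vert y}, q ⟨Q.t e, (hψ.edge_vert e y e.2).2⟩ -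
        q ⟨Q.s e, (hψ.edge_vert e y e.2).1⟩ =
          c' (k e.1) - (p' (P.t (k e.1)) - p' (P.s (k e.1))) := hq
    have hfx : ∀ x : F.V, ψ (vert (f x.1)) = vert y := by
      intro x; rw [← hf]; exact x.2
    refine ⟨fun x => p' x.1 + q ⟨f x.1, hfx x⟩, ?_⟩
    intro e
    have hce : c e = c' e.1 := by
      have h : ψ (φ (edge e.1)) = vert y := e.2
      simp only [c', dif_pos h]
      rfl
    have hqe : ∀ (x : F.V) (z : Q.V) (hz : ψ (vert z) = vert y), φ (vert x.1) = vert z →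
        q ⟨f x.1, hfx x⟩ = q ⟨z, hz⟩ := by
      intro x z hz hx
      have : f x.1 = z := by have := (hf x.1).symm.trans hx; injection this
      subst this; rfl
    rw [hce]
    have hey : ψ (φ (edge e.1)) = vert y := e.2
    cases hc : φ (edge e.1) with
    | vert z =>
      have hz : ψ (vert z) = vert y := by rw [← hc]; exact hey
      have h := hφ.edge_vert e.1 z hc
      have := hp' z e.1 hc
      change p' (P.t e.1) + q ⟨f (F.t e).1, hfx (F.t e)⟩ -
        (p' (P.s e.1) + q ⟨f (F.s e).1, hfx (F.s e)⟩) = c' e.1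
      rw [hqe (F.t e) z hz h.2, hqe (F.s e) z hz h.1, ← this]
      ring
    | edge e' =>
      have he' : ψ (edge e') = vert y := by rw [← hc]; exact hey
      have h := hφ.edge_edge e.1 e' hc
      have hke : k e' = e.1 := hφ.inj_edge (hk e') hc
      have := hq' ⟨e', he'⟩
      simp only [hke] at this
      change p' (P.t e.1) + q ⟨f (F.t e).1, hfx (F.t e)⟩ -
        (p' (P.s e.1) + q ⟨f (F.s e).1, hfx (F.s e)⟩) = c' e.1
      rw [hqe (F.t e) _ (hψ.edge_vert e' y he').2 h.2,
        hqe (F.s e) _ (hψ.edge_vert e' y he').1 h.1]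
      linarith
    | star => rw [hc, hψ.map_star] at hey; cases hey

theorem IsMinor.comp {P Q R : FinQuiver} {φ : Cell P → Cell Q} {ψ : Cell Q → Cell R}
    (hφ : IsMinor φ) (hψ : IsMinor ψ) : IsMinor (ψ ∘ φ) where
  map_star := by simp [hφ.map_star, hψ.map_star]
  image_vert := by rw [Set.image_comp, hφ.image_vert, hψ.image_vert]
  edge_vert := hφ.comp_edge_vert hψ
  edge_edge e e' h := by
    cases hc : φ (edge e) with
    | vert x =>
      obtain ⟨z, hz⟩ := hψ.exists_vert x
      simp only [Function.comp, hc, hz] at h; cases h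
    | edge e'' =>
      simp only [Function.comp, hc] at h
      simp only [Function.comp, (hφ.edge_edge e e'' hc).1, (hφ.edge_edge e e'' hc).2]
      exact hψ.edge_edge e'' e' h
    | star => simp only [Function.comp, hc, hψ.map_star] at h; cases h
  bijOn := by
    have sub : ψ ⁻¹' Set.range edge ⊆ Set.range edge := by
      rintro c ⟨e, he⟩
      cases c with
      | vert x => obtain ⟨z, hz⟩ := hψ.exists_vert x; rw [hz] at he; cases he
      | edge e' => exact ⟨e', rfl⟩
      | star => rw [hψ.map_star] at he; cases he
    refine hψ.bijOn.comp ⟨fun c hc => hc, ?_, ?_⟩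
    · intro c hc d hd h
      exact hφ.bijOn.injOn (sub hc) (sub hd) h
    · intro c hc
      obtain ⟨d, -, rfl⟩ := hφ.bijOn.surjOn (sub hc)
      exact ⟨d, hc, rfl⟩
  tree := hφ.comp_tree hψ

/-- The category of finite quivers and minor morphisms. -/
instance : Category FinQuiver where
  Hom P Q := {φ : Cell P → Cell Q // IsMinor φ}
  id Q := ⟨id, isMinor_id Q⟩
  comp φ ψ := ⟨ψ.1 ∘ φ.1, φ.2.comp ψ.2⟩

end FinQuiver

/-! ## Directed cones -/

open FinQuiver FinQuiver.Cell

/-- A directed cone over a connected finite quiver `base`: the base, and for every vertex `x` of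
the base the direction of the edge between `x` and the cone point. -/
structure DirectedCone where
  /-- the quiver over which the cone is taken -/
  base : FinQuiver
  connected : base.Connected
  /-- `up x` holds if the cone edge at `x` goes from `x` to the cone point -/
  up : base.V → Bool

namespace DirectedCone

/-- The quiver underlying a directed cone: the vertices are those of the base and the cone point
`none`; the edges are those of the base and one cone edge `Sum.inr x` for each base vertex `x`. -/
def quiver (C : DirectedCone) : FinQuiver where
  V := Option C.base.V
  E := C.base.E ⊕ C.base.V
  s := Sum.elim (fun e => some (C.base.s e)) (fun x => if C.up x then some x else none)
  t := Sum.elim (fun e => some (C.base.t e)) (fun x => if C.up x then none else some x)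
  finite_V := by have := C.base.finite_V; exact inferInstance
  finite_E := by have := C.base.finite_V; have := C.base.finite_E; exact inferInstance

/-- Base contractions: edges of the base are contracted, and afterwards all but one of each family
of cone edges which have become parallel are deleted. (That exactly one cone edge at each vertex
survives is part of `φ` being a minor morphism.) -/
structure IsBaseContraction {C D : DirectedCone} (φ : C.quiver ⟶ D.quiver) : Prop where
  conePoint : φ.1 (vert none) = vert none
  baseVertex : ∀ x : C.base.V, ∃ y : D.base.V, φ.1 (vert (some x)) = vert (some y)
  baseEdge : ∀ e : C.base.E, (∃ y : D.base.V, φ.1 (edge (Sum.inl e)) = vert (some y)) ∨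
    ∃ e' : D.base.E, φ.1 (edge (Sum.inl e)) = edge (Sum.inl e')
  coneEdge : ∀ x : C.base.V, φ.1 (edge (Sum.inr x)) = star ∨
    ∃ y : D.base.V, φ.1 (edge (Sum.inr x)) = edge (Sum.inr y)

/-- Base deletions: edges of the base are deleted. -/
structure IsBaseDeletion {C D : DirectedCone} (φ : C.quiver ⟶ D.quiver) : Prop where
  conePoint : φ.1 (vert none) = vert none
  baseVertex : ∀ x : C.base.V, ∃ y : D.base.V, φ.1 (vert (some x)) = vert (some y)
  baseEdge : ∀ e : C.base.E, φ.1 (edge (Sum.inl e)) = star ∨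
    ∃ e' : D.base.E, φ.1 (edge (Sum.inl e)) = edge (Sum.inl e')
  coneEdge : ∀ x : C.base.V, ∃ y : D.base.V, φ.1 (edge (Sum.inr x)) = edge (Sum.inr y)

/-- Base minor morphisms: compositions of base contractions and base deletions. -/
inductive IsBaseMinor : ∀ {C D : DirectedCone}, (C.quiver ⟶ D.quiver) → Prop
  | contraction {C D : DirectedCone} (φ : C.quiver ⟶ D.quiver) :
      IsBaseContraction φ → IsBaseMinor φ
  | deletion {C D : DirectedCone} (φ : C.quiver ⟶ D.quiver) :
      IsBaseDeletion φ → IsBaseMinor φ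
  | comp {B C D : DirectedCone} (φ : B.quiver ⟶ C.quiver) (ψ : C.quiver ⟶ D.quiver) :
      IsBaseMinor φ → IsBaseMinor ψ → IsBaseMinor (φ ≫ ψ)

theorem isBaseMinor_id (C : DirectedCone) : IsBaseMinor (𝟙 C.quiver) :=
  .deletion _ ⟨rfl, fun x => ⟨x, rfl⟩, fun e => .inr ⟨e, rfl⟩, fun x => ⟨x, rfl⟩⟩

/-- The category of directed cones and base minor morphisms. -/
instance : Category DirectedCone where
  Hom C D := {φ : C.quiver ⟶ D.quiver // IsBaseMinor φ}
  id C := ⟨𝟙 C.quiver, isBaseMinor_id C⟩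
  comp φ ψ := ⟨φ.1 ≫ ψ.1, .comp _ _ φ.2 ψ.2⟩

end DirectedCone

/-- The category of directed cones whose base has genus at most `g`, with base minor morphisms. -/
abbrev ConeQuiver (g : ℕ) : Type 1 :=
  ObjectProperty.FullSubcategory (fun C : DirectedCone => C.base.genus ≤ g)

/-!
# Cones over quivers of bounded genus

A base minor morphism of directed cones is the same thing as a minor morphism `φ` of the bases
together with a section of `φ` on vertices along which the directions of the cone edges agree: the
section records which cone edges survive. The opposite of the category of cones is compared with
the category `TreeCone g` of cones whose base carries a planar rooted spanning tree, in which the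
(at most `g`) remaining edges are numbered. A planar rooted tree is encoded by its vertices in
depth-first order `0, …, n` and its ancestor relation, and a morphism is an embedding of spanning
trees which preserves everything else. Such an embedding `f` has a right adjoint `proj` with respect
to the ancestor order; this is a contraction of spanning trees in the opposite direction, with
section `f`, and it defines the functor `TreeCone.toConeQuiver` to the opposite of the category of
cones.

* `TreeCone g` is Gröbner. Comparing embeddings lexicographically makes `Hom(c, -)` orderable. It is
  Noetherian by Kruskal's theorem with finitely many labels (`BinaryTree.wellQuasiOrdered_emb`),
  where the labels of the vertices of `d` record the directions of edges and a morphism `c ⟶ d`.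
  Passing from planar forests to binary trees, by the first-child/next-sibling encoding, reduces
  this to a minimal bad sequence argument for binary trees.
* The functor is essentially surjective, because a connected quiver has a planar spanning tree with
  as many edges outside of it as the genus (`TreeCone.exists_iso`).
* The functor has property (F): given a base minor morphism from the cone of `c` to `D`, all
  contracted tree edges can be contracted first, except those above the vertices in the image of
  the section and above the end points of additional edges. Since a morphism deletes at most `g`
  base edges, the intermediate tree cone has bounded size
  (`TreeCone.exists_bounded_factorization`).

The assertion on representations holds for every quasi-Gröbner category
(`IsQuasiGrobner.isFinGenRep_subrep`). For a Gröbner category it is proved with Gröbner bases: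
the ideals of leading coefficients form a monotone map from a well-quasi-order to the ideals of a
Noetherian ring, so finitely many of them determine all others, and lifts of their generators
generate (`exists_finite_grobnerBasis`).
-/

/-! ### Gröbner bases in free modules on a functor to sets -/

section GrobnerBasis

theorem WellQuasiOrdered.exists_finite_basis {α : Type*} {r : α → α → Prop}
    (h : WellQuasiOrdered r) : ∃ F : Set α, F.Finite ∧ ∀ x, ∃ y ∈ F, r y x := by
  by_contra! hF
  obtain ⟨f, -, hf⟩ := exists_seq_of_forall_finset_exists (fun _ : α => True)
    (fun x y => ¬ r x y) (fun s _ => by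
      obtain ⟨x, hx⟩ := hF s s.finite_toSet
      exact ⟨x, trivial, hx⟩)
  obtain ⟨m, n, hmn, hr⟩ := h f
  exact hf m n hmn hr

/-- A monotone map from a well-quasi-order to the submodules of a Noetherian module takes all of
its values on a finite set that meets every fibre from below. -/
theorem WellQuasiOrdered.exists_finite_basis_submodule {α : Type*} [Preorder α]
    (h : WellQuasiOrdered ((· ≤ ·) : α → α → Prop)) {A : Type*} [Ring A] {M : Type*}
    [AddCommGroup M] [Module A M] [IsNoetherian A M] (I : α → Submodule A M) (hI : Monotone I) :
    ∃ F : Set α, F.Finite ∧ ∀ x, ∃ y ∈ F, y ≤ x ∧ I y = I x := by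
  refine WellQuasiOrdered.exists_finite_basis (r := fun y x => y ≤ x ∧ I y = I x) fun f => ?_
  obtain ⟨g, hg⟩ := h.exists_monotone_subseq f
  obtain ⟨n, hn⟩ := monotone_stabilizes_iff_noetherian.2 ‹IsNoetherian A M›
    ⟨fun k => I (f (g k)), fun i j hij => hI (hg i j hij)⟩
  exact ⟨g n, g (n + 1), g.strictMono n.lt_succ_self, hg _ _ n.le_succ, hn _ n.le_succ⟩

theorem injective_of_rel_imp_rel {α β : Type*} (r : α → α → Prop) (s : β → β → Prop)
    [IsWellOrder α r] [IsWellOrder β s] (f : α → β) (h : ∀ x y, r x y → s (f x) (f y)) :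
    Function.Injective f := by
  intro x y hxy
  rcases trichotomous_of r x y with H | H | H
  · exact absurd (hxy ▸ h x y H) (irrefl_of s _)
  · exact H
  · exact absurd (hxy ▸ h y x H) (irrefl_of s _)

variable {C : Type u} [Category.{v} C] {A : Type a} [Ring A]

/-- The ideal of leading coefficients at the monomial `t` of the family `K` of submodules of the
free modules on the sets `S(c)`. -/
noncomputable def leadIdeal {S : C ⥤ Type v'} (r : ∀ c : C, S.obj c → S.obj c → Prop)
    (K : ∀ c, Submodule A (S.obj c →₀ A)) (t : TotalSet S) : Submodule A A :=
  (K t.1 ⊓ Finsupp.supported A A {x | x = t.2 ∨ r t.1 x t.2}).map (Finsupp.lapply t.2)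

theorem leadIdeal_mono {S : C ⥤ Type v'} {r : ∀ c : C, S.obj c → S.obj c → Prop}
    (hr : ∀ c, IsWellOrder (S.obj c) (r c))
    (hS : ∀ (c d : C) (h : c ⟶ d) (x y : S.obj c), r c x y → r d (S.map h x) (S.map h y))
    {K : ∀ c, Submodule A (S.obj c →₀ A)}
    (hK : ∀ {c d : C} (h : c ⟶ d) (f : S.obj c →₀ A), f ∈ K c → f.mapDomain (S.map h) ∈ K d) :
    Monotone (leadIdeal r K) := by
  classical
  rintro ⟨c, s⟩ ⟨d, s'⟩ ⟨h, hs⟩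
  change c ⟶ d at h
  obtain rfl : S.map h s = s' := hs
  rintro _ ⟨f, ⟨hf, hfs⟩, rfl⟩
  have inj := injective_of_rel_imp_rel (r c) (r d) (S.map h) (hS c d h)
  refine ⟨f.mapDomain (S.map h), ⟨hK h f hf, ?_⟩, ?_⟩
  · intro x hx
    obtain ⟨y, hy, rfl⟩ := Finset.mem_image.1 (Finsupp.mapDomain_support hx)
    rcases hfs hy with rfl | H
    · exact Or.inl rfl
    · exact Or.inr (hS _ _ h _ _ H)
  · exact Finsupp.mapDomain_apply inj f s

/-- Every stable family `K` of submodules of the free modules on the sets `S(c)` is generated by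
finitely many elements: lifts of generators of finitely many ideals of leading coefficients. -/
theorem exists_finite_grobnerBasis [IsNoetherianRing A] {S : C ⥤ Type v'} (hord : IsOrderable S)
    (hwqo : WellQuasiOrdered ((· ≤ ·) : TotalSet S → TotalSet S → Prop))
    {K : ∀ c, Submodule A (S.obj c →₀ A)}
    (hK : ∀ {c d : C} (h : c ⟶ d) (f : S.obj c →₀ A), f ∈ K c → f.mapDomain (S.map h) ∈ K d) :
    ∃ B : Set (Σ c, S.obj c →₀ A), B.Finite ∧ (∀ b ∈ B, b.2 ∈ K b.1) ∧
      ∀ K' : ∀ c, Submodule A (S.obj c →₀ A),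
        (∀ {c d : C} (h : c ⟶ d) (f : S.obj c →₀ A), f ∈ K' c → f.mapDomain (S.map h) ∈ K' d) →
        (∀ b ∈ B, b.2 ∈ K' b.1) → ∀ c, K c ≤ K' c := by
  classical
  obtain ⟨r, hr, hS⟩ := hord
  obtain ⟨F, hF, hFI⟩ := hwqo.exists_finite_basis_submodule (leadIdeal r K)
    (leadIdeal_mono hr hS hK)
  have hgen : ∀ t : TotalSet S, ∃ G : Set (S.obj t.1 →₀ A), G.Finite ∧
      G ⊆ ↑(K t.1 ⊓ Finsupp.supported A A {x | x = t.2 ∨ r t.1 x t.2}) ∧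
      leadIdeal r K t = (Submodule.span A G).map (Finsupp.lapply t.2) := by
    intro t
    obtain ⟨G, hG⟩ := (isNoetherian_def.1 (inferInstance : IsNoetherian A A)) (leadIdeal r K t)
    have hsub : (G : Set A) ⊆ Finsupp.lapply (R := A) t.2 ''
        ↑(K t.1 ⊓ Finsupp.supported A A {x | x = t.2 ∨ r t.1 x t.2}) := by
      have := Submodule.subset_span (R := A) (s := (G : Set A))
      rw [hG] at this
      exact this
    obtain ⟨G', hG', hfin, himg⟩ := Set.exists_subset_image_finite_and
      (p := fun X => X = (G : Set A)) |>.1 ⟨(G : Set A), hsub, G.finite_toSet, rfl⟩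
    refine ⟨G', hfin, hG', ?_⟩
    rw [← hG, Submodule.map_span, himg]
  choose G hGfin hGK hGI using hgen
  refine ⟨⋃ t ∈ F, (fun f => ⟨t.1, f⟩) '' G t, hF.biUnion fun t _ => (hGfin t).image _, ?_, ?_⟩
  · intro b hb
    simp only [Set.mem_iUnion] at hb
    obtain ⟨t, ht, f, hf, rfl⟩ := hb
    exact (hGK t hf).1
  · intro K' hK' hB c
    have hGK' : ∀ t ∈ F, ∀ f ∈ G t, f ∈ K' t.1 := fun t ht f hf =>
      hB ⟨t.1, f⟩ (Set.mem_biUnion ht ⟨f, hf, rfl⟩)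
    have key : ∀ s : S.obj c, ∀ f ∈ K c, (∀ x ∈ f.support, x = s ∨ r c x s) → f ∈ K' c := by
      intro s
      induction s using (hr c).wf.induction with
      | _ s ih =>
        intro f hf hfs
        -- an element of both families with the same coefficient as `f` at `s`
        obtain ⟨f', hf'K, hf'K', hf's, hf'e⟩ : ∃ f' ∈ K c, f' ∈ K' c ∧
            (∀ x ∈ f'.support, x = s ∨ r c x s) ∧ f' s = f s := by
          obtain ⟨⟨d, u⟩, ht, ⟨h, hh⟩, hI⟩ := hFI ⟨c, s⟩
          change d ⟶ c at h
          obtain rfl : S.map h u = s := hh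
          have hmem : f (S.map h u) ∈ leadIdeal r K ⟨c, S.map h u⟩ := ⟨f, ⟨hf, hfs⟩, rfl⟩
          rw [← hI] at hmem
          replace hmem : _ ∈ Submodule.map _ _ := (hGI ⟨d, u⟩).le hmem
          obtain ⟨q, hq, hqe⟩ := hmem
          have hqK := Submodule.span_le.2 (hGK ⟨d, u⟩) hq
          have hqK' : q ∈ K' d := Submodule.span_le.2 (hGK' _ ht) hq
          have inj := injective_of_rel_imp_rel (r d) (r c) (S.map h) (hS d c h)
          refine ⟨q.mapDomain (S.map h), hK h q hqK.1, hK' h q hqK', ?_, ?_⟩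
          · intro x hx
            obtain ⟨y, hy, rfl⟩ := Finset.mem_image.1 (Finsupp.mapDomain_support hx)
            rcases hqK.2 hy with rfl | H
            · exact Or.inl rfl
            · exact Or.inr (hS _ _ h _ _ H)
          · rw [Finsupp.mapDomain_apply inj]
            exact hqe
        suffices hsub : f - f' ∈ K' c by
          have := (K' c).add_mem hsub hf'K'
          rwa [sub_add_cancel] at this
        have hlt : ∀ x ∈ (f - f').support, r c x s := by
          intro x hx
          have hx' : f x - f' x ≠ 0 := by simpa using hx
          have hxs : x ≠ s := by
            rintro rfl
            exact hx' (by rw [hf'e, sub_self])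
          by_cases h : f x = 0
          · refine (hf's x ?_).resolve_left hxs
            rw [Finsupp.mem_support_iff]
            intro h'
            exact hx' (by rw [h, h', sub_zero])
          · exact (hfs x (Finsupp.mem_support_iff.2 h)).resolve_left hxs
        rcases (f - f').support.eq_empty_or_nonempty with h0 | hne
        · rw [Finsupp.support_eq_empty.1 h0]
          exact (K' c).zero_mem
        · let _ := linearOrderOfSTO (r c)
          obtain ⟨m, hm, hmax⟩ := (f - f').support.exists_max_image id hne
          refine ih m (hlt m hm) _ ((K c).sub_mem hf hf'K) fun x hx => ?_
          exact (hmax x hx)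
    intro f hf
    rcases f.support.eq_empty_or_nonempty with h0 | hne
    · rw [Finsupp.support_eq_empty.1 h0]
      exact (K' c).zero_mem
    · let _ := linearOrderOfSTO (r c)
      obtain ⟨m, hm, hmax⟩ := f.support.exists_max_image id hne
      exact key m f hf fun x hx => hmax x hx

end GrobnerBasis

/-! ### Representations of quasi-Gröbner categories -/

section NoetherianRepresentations

variable {C : Type u} [Category.{v} C] {A : Type a} [Ring A]

/-- A submodule of a representation is finitely generated if it is the smallest one containing
some finite set of homogeneous elements. -/
def Subrep.FG {M : C ⥤ ModuleCat.{b} A} (N : Subrep M) : Prop :=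
  ∃ T : Set (Σ c, M.obj c), T.Finite ∧ (∀ t ∈ T, t.2 ∈ N.obj t.1) ∧
    ∀ N' : Subrep M, (∀ t ∈ T, t.2 ∈ N'.obj t.1) → ∀ c, N.obj c ≤ N'.obj c

/-- A finitely generated representation has a finite set of homogeneous generators, the components
of the elements of a finite set of generators. -/
theorem IsFinGenRep.exists_finite_homogeneous {M : C ⥤ ModuleCat.{b} A} (hM : IsFinGenRep M) :
    ∃ T : Set (Σ c, M.obj c), T.Finite ∧
      ∀ N : Subrep M, (∀ t ∈ T, t.2 ∈ N.obj t.1) → ∀ c, N.obj c = ⊤ := by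
  classical
  obtain ⟨S, hS, hspan⟩ := hM
  refine ⟨⋃ s ∈ S, (fun c => ⟨c, s c⟩) '' (DFinsupp.support s : Set C),
    hS.biUnion fun s _ => (Finset.finite_toSet _).image _, fun N hN c => ?_⟩
  rw [eq_top_iff, ← hspan c]
  refine sInf_le ⟨N, fun s hs d => ?_, rfl⟩
  by_cases h : s d = 0
  · rw [h]
    exact (N.obj d).zero_mem
  · exact hN ⟨d, s d⟩ (Set.mem_biUnion hs ⟨d, DFinsupp.mem_support_iff.2 h, rfl⟩)

/-- A submodule of `N.toRep`, as a submodule of the ambient representation. -/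
def Subrep.ofToRep {M : C ⥤ ModuleCat.{b} A} {N : Subrep M} (R : Subrep N.toRep) : Subrep M where
  obj c := (R.obj c).map (N.obj c).subtype
  map_mem := by
    rintro c d h _ ⟨x, hx, rfl⟩
    exact ⟨_, R.map_mem h x hx, rfl⟩

theorem Subrep.FG.isFinGenRep {M : C ⥤ ModuleCat.{b} A} {N : Subrep M} (hN : N.FG) :
    IsFinGenRep N.toRep := by
  classical
  obtain ⟨T, hT, hTN, hgen⟩ := hN
  let g : T → DirectSum C fun c => N.toRep.obj c := fun t =>
    DirectSum.of (fun c => N.toRep.obj c) t.1.1 ⟨t.1.2, hTN t.1 t.2⟩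
  have := hT.to_subtype
  refine ⟨Set.range g, Set.finite_range g, fun c => ?_⟩
  refine sInf_eq_top.2 ?_
  rintro P ⟨R, hR, rfl⟩
  have key := hgen (Subrep.ofToRep R) (fun t ht => by
    refine ⟨⟨t.2, hTN t ht⟩, ?_, rfl⟩
    have := hR (g ⟨t, ht⟩) ⟨_, rfl⟩ t.1
    have hg : g ⟨t, ht⟩ t.1 = ⟨t.2, hTN t ht⟩ := DirectSum.of_eq_same _ _
    exact hg ▸ this) c
  rw [eq_top_iff]
  rintro ⟨x, hx⟩ -
  obtain ⟨y, hy, hyx⟩ := key hx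
  have : y = ⟨x, hx⟩ := Subtype.ext hyx
  exact this ▸ hy

/-- The disjoint union of the functors `Hom(x i, -)`. -/
def sumCoyoneda {k : ℕ} (x : Fin k → C) : C ⥤ Type v where
  obj y := Σ i, (x i ⟶ y)
  map h := TypeCat.ofHom fun p => ⟨p.1, p.2 ≫ h⟩

theorem IsGrobner.isOrderable_sumCoyoneda (hC : IsGrobner C) {k : ℕ} (x : Fin k → C) :
    IsOrderable (sumCoyoneda x) := by
  choose r hr hmono using fun i => (hC.2 (x i)).1
  refine ⟨fun c => Sigma.Lex (· < ·) fun i => r i c, fun c => ?_, ?_⟩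
  · have (i : Fin k) : IsWellOrder (x i ⟶ c) (r i c) := hr i c
    refine { wf := ?_, trichotomous := ?_ }
    · refine Subrelation.wf (r := InvImage (PSigma.Lex (· < ·) fun i => r i c)
        fun p : Σ i, (x i ⟶ c) => ⟨p.1, p.2⟩) ?_
        (InvImage.wf _ (WellFounded.psigma_lex wellFounded_lt fun i => (hr i c).wf))
      rintro _ _ (⟨p, q, hpq⟩ | ⟨p, q, hpq⟩)
      · exact PSigma.Lex.left _ _ hpq
      · exact PSigma.Lex.right _ hpq
    · rintro ⟨i, p⟩ ⟨j, q⟩ h₁ h₂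
      rcases lt_trichotomy i j with H | rfl | H
      · exact absurd (Sigma.Lex.left _ _ H) h₁
      · rcases trichotomous_of (r i c) p q with H | rfl | H
        · exact absurd (Sigma.Lex.right (s := fun i => r i c) _ _ H) h₁
        · rfl
        · exact absurd (Sigma.Lex.right (s := fun i => r i c) _ _ H) h₂
      · exact absurd (Sigma.Lex.left _ _ H) h₂
  · rintro c d h _ _ (⟨p, q, hpq⟩ | ⟨p, q, hpq⟩)
    · exact Sigma.Lex.left _ _ hpq
    · exact Sigma.Lex.right _ _ (hmono _ c d h p q hpq)

theorem IsGrobner.wellQuasiOrdered_sumCoyoneda (hC : IsGrobner C) {k : ℕ} (x : Fin k → C) :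
    WellQuasiOrdered
      ((· ≤ ·) : TotalSet (sumCoyoneda x) → TotalSet (sumCoyoneda x) → Prop) := by
  intro f
  obtain ⟨g, hg⟩ := (Finite.wellQuasiOrdered (Eq : Fin k → Fin k → Prop)).exists_monotone_subseq
    fun n => (f n).2.1
  set i := (f (g 0)).2.1 with hi
  have hcast : ∀ n, ∃ p : x i ⟶ (f (g n)).1, (f (g n)).2 = ⟨i, p⟩ := by
    intro n
    have h := hg 0 n (Nat.zero_le n)
    rw [← hi] at h
    generalize f (g n) = t at h
    obtain ⟨y, j, p⟩ := t
    dsimp only at h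
    subst h
    exact ⟨p, rfl⟩
  choose p hp using hcast
  obtain ⟨m, n, hmn, hle⟩ := (hC.2 (x i)).2.wqo fun n =>
    toAntisymmetrization (· ≤ ·) (⟨(f (g n)).1, p n⟩ : TotalSet (coyoneda.obj (Opposite.op (x i))))
  obtain ⟨h, hh⟩ := toAntisymmetrization_le_toAntisymmetrization_iff.1 hle
  refine ⟨g m, g n, g.strictMono hmn, h, ?_⟩
  rw [hp m, hp n, ← show p m ≫ h = p n from hh]
  rfl

/-- Submodules of finitely generated representations of a Gröbner category are finitely
generated: they are images of submodules of a finite sum of principal projectives. -/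
theorem IsGrobner.subrep_fg [IsNoetherianRing A] (hC : IsGrobner C) {M : C ⥤ ModuleCat.{b} A}
    {T : Set (Σ c, M.obj c)} (hT : T.Finite)
    (hM : ∀ N : Subrep M, (∀ t ∈ T, t.2 ∈ N.obj t.1) → ∀ c, N.obj c = ⊤) (N : Subrep M) :
    N.FG := by
  have := hT.to_subtype
  obtain ⟨k, ⟨e⟩⟩ := Finite.exists_equiv_fin T
  let x : Fin k → C := fun i => (e.symm i).1.1
  let m : ∀ i, M.obj (x i) := fun i => (e.symm i).1.2
  let ev : ∀ c, ((sumCoyoneda x).obj c →₀ A) →ₗ[A] M.obj c := fun c =>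
    Finsupp.linearCombination A fun p => (M.map p.2).hom (m p.1)
  have hev : ∀ {c d : C} (h : c ⟶ d) (f : (sumCoyoneda x).obj c →₀ A),
      ev d (f.mapDomain ((sumCoyoneda x).map h)) = (M.map h).hom (ev c f) := by
    intro c d h f
    simp only [ev]
    rw [Finsupp.linearCombination_mapDomain, Finsupp.apply_linearCombination]
    congr 2
    funext p
    change (M.map (p.2 ≫ h)).hom (m p.1) = _
    rw [M.map_comp]
    rfl
  have hsurj : ∀ c, Function.Surjective (ev c) := by
    intro c
    rw [← LinearMap.range_eq_top]
    refine hM ⟨fun c => LinearMap.range (ev c), ?_⟩ ?_ c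
    · rintro c d h _ ⟨f, rfl⟩
      exact ⟨_, hev h f⟩
    · intro t ht
      obtain ⟨i, hi⟩ := e.symm.surjective ⟨t, ht⟩
      obtain rfl : (e.symm i).1 = t := congrArg Subtype.val hi
      refine ⟨Finsupp.single ⟨i, 𝟙 _⟩ 1, ?_⟩
      exact (Finsupp.linearCombination_single _ _ _).trans (by simp [m, x])
  obtain ⟨B, hB, hBK, hgen⟩ := exists_finite_grobnerBasis
    (hC.isOrderable_sumCoyoneda x) (hC.wellQuasiOrdered_sumCoyoneda x)
    (K := fun c => (N.obj c).comap (ev c)) (fun h f hf => by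
      rw [Submodule.mem_comap, hev]
      exact N.map_mem h _ hf)
  refine ⟨(fun b => ⟨b.1, ev b.1 b.2⟩) '' B, hB.image _, ?_, fun N' hN' c n hn => ?_⟩
  · rintro _ ⟨b, hb, rfl⟩
    exact hBK b hb
  · obtain ⟨f, rfl⟩ := hsurj c n
    exact hgen (fun c => (N'.obj c).comap (ev c)) (fun h f hf => by
      rw [Submodule.mem_comap, hev]
      exact N'.map_mem h _ hf) (fun b hb => hN' _ ⟨b, hb, rfl⟩) c hn

/-- The restriction of a submodule along a functor. -/
def Subrep.restrict {D : Type u'} [Category.{v'} D] (F : D ⥤ C) {M : C ⥤ ModuleCat.{b} A}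
    (N : Subrep M) : Subrep (F ⋙ M) where
  obj y := N.obj (F.obj y)
  map_mem h := N.map_mem (F.map h)

/-- The largest submodule of `M` whose restriction along `F` is contained in `R`. -/
def Subrep.coinduce {D : Type u'} [Category.{v'} D] (F : D ⥤ C) {M : C ⥤ ModuleCat.{b} A}
    (R : Subrep (F ⋙ M)) : Subrep M where
  obj c := ⨅ (y : D) (h : c ⟶ F.obj y), (R.obj y).comap (M.map h).hom
  map_mem := by
    intro c d k x hx
    simp only [Submodule.mem_iInf, Submodule.mem_comap] at hx ⊢
    intro y h
    have := hx y (k ≫ h)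
    rwa [M.map_comp] at this

theorem IsQuasiGrobner.isFinGenRep_subrep [IsNoetherianRing A] (hC : IsQuasiGrobner C)
    {M : C ⥤ ModuleCat.{b} A} (hM : IsFinGenRep M) (N : Subrep M) : IsFinGenRep N.toRep := by
  apply Subrep.FG.isFinGenRep
  obtain ⟨T, hT, hgen⟩ := hM.exists_finite_homogeneous
  obtain ⟨-, D, _, F, hD, _, hF⟩ := hC
  choose n x δ hδ using fun t : Σ c, M.obj c => hF t.1
  have key : (N.restrict F).FG := by
    refine hD.subrep_fg (T := ⋃ t ∈ T, Set.range fun i => ⟨x t i, (M.map (δ t i)).hom t.2⟩)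
      (hT.biUnion fun t _ => Set.finite_range _) (fun R hR y => ?_) _
    have htop := hgen (Subrep.coinduce F R) (fun t ht => by
      simp only [Subrep.coinduce, Submodule.mem_iInf, Submodule.mem_comap]
      intro y h
      obtain ⟨i, γ, rfl⟩ := hδ t y h
      rw [M.map_comp]
      exact R.map_mem γ _ (hR _ (Set.mem_biUnion ht ⟨i, rfl⟩))) (F.obj y)
    rw [eq_top_iff] at htop ⊢
    intro z _
    have hz := htop (Submodule.mem_top (x := z))
    simp only [Subrep.coinduce, Submodule.mem_iInf, Submodule.mem_comap] at hz
    simpa using hz y (𝟙 _)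
  obtain ⟨T', hT', hT'N, hgen'⟩ := key
  refine ⟨(fun t => ⟨F.obj t.1, t.2⟩) '' T', hT'.image _, ?_, fun N' hN' c z hz => ?_⟩
  · rintro _ ⟨t, ht, rfl⟩
    exact hT'N t ht
  · have h := hgen' (N'.restrict F) (fun t ht => hN' _ ⟨t, ht, rfl⟩) (F.objPreimage c)
      (N.map_mem (F.objObjPreimageIso c).inv z hz)
    have h' := N'.map_mem (F.objObjPreimageIso c).hom _ h
    simpa [← ModuleCat.comp_apply, ← M.map_comp] using h'

end NoetherianRepresentations

/-! ### Connectivity and genus of quivers -/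

namespace FinQuiver

theorem Connected.range_boundary {Q : FinQuiver} (hQ : Q.Connected) :
    LinearMap.range Q.boundary =
      LinearMap.ker (Finsupp.linearCombination ℚ fun _ : Q.V => (1 : ℚ)) := by
  apply le_antisymm
  · rintro _ ⟨f, rfl⟩
    rw [LinearMap.mem_ker, ← LinearMap.comp_apply]
    suffices h : (Finsupp.linearCombination ℚ fun _ : Q.V => (1 : ℚ)) ∘ₗ Q.boundary = 0 by
      rw [h, LinearMap.zero_apply]
    ext e
    simp [boundary]
  · obtain ⟨⟨x₀⟩, hc⟩ := hQ
    have hsub : ∀ x, Finsupp.single x (1 : ℚ) - Finsupp.single x₀ 1 ∈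
        LinearMap.range Q.boundary := by
      intro x
      induction hc x x₀ with
      | rel p q h =>
        obtain ⟨e, rfl, rfl⟩ := h
        exact ⟨Finsupp.single e (-1), by simp [boundary]⟩
      | refl p => simp
      | symm p q _ ih =>
        rw [← neg_sub]
        exact Submodule.neg_mem _ ih
      | trans p q r _ _ ih₁ ih₂ =>
        rw [← sub_add_sub_cancel _ (Finsupp.single q (1 : ℚ))]
        exact Submodule.add_mem _ ih₁ ih₂
    intro f hf
    have h : f = f.sum fun x a => a • (Finsupp.single x (1 : ℚ) - Finsupp.single x₀ 1) := by
      have hf' : (f.sum fun _ a => a) = 0 := by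
        simpa [Finsupp.linearCombination_apply] using hf
      simp only [smul_sub, Finsupp.smul_single, smul_eq_mul, mul_one]
      rw [Finsupp.sum_sub, Finsupp.sum_single]
      have : (f.sum fun _ a => Finsupp.single x₀ a) = Finsupp.single x₀ (f.sum fun _ a => a) := by
        simp [Finsupp.sum, Finsupp.single_finsetSum]
      rw [this, hf', Finsupp.single_zero, sub_zero]
    rw [h]
    exact Submodule.sum_mem _ fun x _ => Submodule.smul_mem _ _ (hsub x)

/-- Euler's formula for connected quivers. -/
theorem Connected.genus_add_card {Q : FinQuiver} (hQ : Q.Connected) :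
    Q.genus + Nat.card Q.V = Nat.card Q.E + 1 := by
  have := Q.finite_V
  have := Q.finite_E
  have := Fintype.ofFinite Q.V
  have := Fintype.ofFinite Q.E
  obtain ⟨x₀⟩ := hQ.1
  have h₁ := Q.boundary.finrank_range_add_finrank_ker
  have h₂ := (Finsupp.linearCombination ℚ fun _ : Q.V => (1 : ℚ)).finrank_range_add_finrank_ker
  have h₃ : LinearMap.range (Finsupp.linearCombination ℚ fun _ : Q.V => (1 : ℚ)) = ⊤ :=
    LinearMap.range_eq_top.2 fun a => ⟨Finsupp.single x₀ a, by simp⟩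
  rw [h₃, finrank_top, Module.finrank_self, Module.finrank_finsupp_self] at h₂
  rw [hQ.range_boundary, Module.finrank_finsupp_self] at h₁
  rw [genus, Nat.card_eq_fintype_card, Nat.card_eq_fintype_card]
  omega

/-- A quiver is connected if every vertex but one is joined by an edge to a vertex of smaller
height. -/
theorem connected_of_parent {Q : FinQuiver} (r : Q.V) (height : Q.V → ℕ)
    (h : ∀ x, x ≠ r → ∃ (e : Q.E) (y : Q.V), height y < height x ∧
      (Q.s e = x ∧ Q.t e = y ∨ Q.s e = y ∧ Q.t e = x)) : Q.Connected := by
  have hr : ∀ n x, height x = n →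
      Relation.EqvGen (fun p q => ∃ e : Q.E, Q.s e = p ∧ Q.t e = q) x r := by
    intro n
    induction n using Nat.strong_induction_on with
    | _ n ih =>
      intro x hx
      by_cases hxr : x = r
      · rw [hxr]
        exact .refl _
      · obtain ⟨e, y, hy, he⟩ := h x hxr
        refine .trans _ y _ ?_ (ih _ (hx ▸ hy) y rfl)
        rcases he with he | he
        · exact .rel _ _ ⟨e, he⟩
        · exact .symm _ _ (.rel _ _ ⟨e, he⟩)
  exact ⟨⟨r⟩, fun x y => .trans _ _ _ (hr _ x rfl) (.symm _ _ (hr _ y rfl))⟩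

theorem Connected.isTree {Q : FinQuiver} (hQ : Q.Connected)
    (hcard : Nat.card Q.E + 1 ≤ Nat.card Q.V) : Q.IsTree :=
  ⟨hQ, by have := hQ.genus_add_card; omega⟩

/-- The quiver with the same vertices and only the edges in `Y`. -/
def keep (Q : FinQuiver) (Y : Set Q.E) : FinQuiver where
  V := Q.V
  E := Y
  s e := Q.s e
  t e := Q.t e
  finite_V := Q.finite_V
  finite_E := by have := Q.finite_E; exact inferInstance

/-! ### Constructing minor morphisms -/

/-- Sufficient conditions for a minor morphism, in terms of the map `f` of vertices. -/
theorem isMinor_of {P Q : FinQuiver} {φ : Cell P → Cell Q} (f : P.V → Q.V)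
    (vert_eq : ∀ x, φ (vert x) = vert (f x)) (map_star : φ star = star)
    (surj_vert : Function.Surjective f)
    (edge_vert : ∀ (e : P.E) (y : Q.V), φ (edge e) = vert y → f (P.s e) = y ∧ f (P.t e) = y)
    (edge_edge : ∀ (e : P.E) (e' : Q.E), φ (edge e) = edge e' →
      f (P.s e) = Q.s e' ∧ f (P.t e) = Q.t e')
    (surj_edge : ∀ e' : Q.E, ∃ e, φ (edge e) = edge e')
    (inj_edge : ∀ (e₁ e₂ : P.E) (e' : Q.E), φ (edge e₁) = edge e' → φ (edge e₂) = edge e' → e₁ = e₂)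
    (tree : ∀ (y : Q.V) h,
      (P.sub {x | φ (vert x) = vert y} {e | φ (edge e) = vert y} h).IsTree) : IsMinor φ where
  map_star := map_star
  image_vert := by
    ext c
    constructor
    · rintro ⟨_, ⟨x, rfl⟩, rfl⟩
      exact ⟨f x, (vert_eq x).symm⟩
    · rintro ⟨y, rfl⟩
      obtain ⟨x, rfl⟩ := surj_vert y
      exact ⟨vert x, ⟨x, rfl⟩, vert_eq x⟩
  edge_vert e y h := by
    rw [vert_eq, vert_eq, (edge_vert e y h).1, (edge_vert e y h).2]
    exact ⟨rfl, rfl⟩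
  edge_edge e e' h := by
    rw [vert_eq, vert_eq, (edge_edge e e' h).1, (edge_edge e e' h).2]
    exact ⟨rfl, rfl⟩
  bijOn := by
    have hsub : ∀ c e', φ c = edge e' → ∃ e, c = edge e := by
      intro c e' hc
      cases c with
      | vert x => rw [vert_eq] at hc; cases hc
      | edge e => exact ⟨e, rfl⟩
      | star => rw [map_star] at hc; cases hc
    refine ⟨fun c hc => hc, ?_, ?_⟩
    · rintro c₁ ⟨e₁', h₁⟩ c₂ ⟨e₂', h₂⟩ h
      obtain ⟨e₁, rfl⟩ := hsub c₁ e₁' h₁.symm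
      obtain ⟨e₂, rfl⟩ := hsub c₂ e₂' h₂.symm
      rw [inj_edge e₁ e₂ e₁' h₁.symm (h.symm.trans h₁.symm)]
    · rintro _ ⟨e', rfl⟩
      obtain ⟨e, he⟩ := surj_edge e'
      exact ⟨edge e, ⟨e', he.symm⟩, he⟩
  tree y := tree y _

/-- A map of cells which deletes some edges and is an isomorphism otherwise is a minor morphism. -/
theorem isMinor_of_bijective {P Q : FinQuiver} {φ : Cell P → Cell Q} (f : P.V → Q.V)
    (vert_eq : ∀ x, φ (vert x) = vert (f x)) (map_star : φ star = star)
    (bij_vert : Function.Bijective f) (edge_ne : ∀ (e : P.E) (y : Q.V), φ (edge e) ≠ vert y)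
    (edge_edge : ∀ (e : P.E) (e' : Q.E), φ (edge e) = edge e' →
      f (P.s e) = Q.s e' ∧ f (P.t e) = Q.t e')
    (surj_edge : ∀ e' : Q.E, ∃ e, φ (edge e) = edge e')
    (inj_edge : ∀ (e₁ e₂ : P.E) (e' : Q.E), φ (edge e₁) = edge e' → φ (edge e₂) = edge e' →
      e₁ = e₂) : IsMinor φ := by
  refine isMinor_of f vert_eq map_star bij_vert.2 (fun e y h => absurd h (edge_ne e y)) edge_edge
    surj_edge inj_edge fun y h => ?_
  obtain ⟨x, rfl⟩ := bij_vert.2 y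
  refine Connected.isTree (connected_of_parent ⟨x, vert_eq x⟩ (fun _ => 0) ?_) ?_
  · rintro ⟨z, hz⟩ hne
    have hz' : vert (f z) = vert (f x) := (vert_eq z).symm.trans hz
    exact absurd (Subtype.ext (bij_vert.1 (Cell.vert.inj hz'))) hne
  · have : IsEmpty (P.sub _ _ h).E := ⟨fun e => edge_ne _ _ e.2⟩
    have : Finite (P.sub _ _ h).V := (P.sub _ _ h).finite_V
    have : Nonempty (P.sub _ _ h).V := ⟨⟨x, vert_eq x⟩⟩
    rw [Nat.card_of_isEmpty]
    exact Nat.card_pos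

/-- If the composite of a minor morphism `φ` with a map `ψ` is a minor morphism, so is `ψ`. -/
theorem IsMinor.of_comp {P Q R : FinQuiver} {φ : Cell P → Cell Q} {ψ : Cell Q → Cell R}
    (hφ : IsMinor φ) (h : IsMinor (ψ ∘ φ)) : IsMinor ψ := by
  choose f hf using fun y => hφ.surj_vert y
  choose k hk using fun e => hφ.surj_edge e
  choose q hq using fun x => h.exists_vert (f x)
  have hq' : ∀ x, ψ (vert x) = vert (q x) := fun x => by
    rw [← hq, Function.comp_apply, hf]
  have hends : ∀ e, φ (vert (P.s (k e))) = vert (Q.s e) ∧ φ (vert (P.t (k e))) = vert (Q.t e) :=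
    fun e => hφ.edge_edge _ _ (hk e)
  have hψk : ∀ e, (ψ ∘ φ) (edge (k e)) = ψ (edge e) := fun e => congrArg ψ (hk e)
  have hstar : ψ star = star := by
    have := h.map_star
    rwa [Function.comp_apply, hφ.map_star] at this
  have hev : ∀ (e : Q.E) (y : R.V), ψ (edge e) = vert y →
      ψ (vert (Q.s e)) = vert y ∧ ψ (vert (Q.t e)) = vert y := by
    intro e y he
    have := h.edge_vert (k e) y ((hψk e).trans he)
    rwa [Function.comp_apply, Function.comp_apply, (hends e).1, (hends e).2] at this
  refine isMinor_of q hq' hstar ?_ (fun e y he => ?_) (fun e e' he => ?_) ?_ ?_ fun y H => ?_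
  · intro y
    obtain ⟨x, hx⟩ := h.surj_vert y
    obtain ⟨z, hz⟩ := hφ.exists_vert x
    rw [Function.comp_apply, hz, hq'] at hx
    exact ⟨z, Cell.vert.inj hx⟩
  · have := hev e y he
    rw [hq', hq'] at this
    exact ⟨Cell.vert.inj this.1, Cell.vert.inj this.2⟩
  · have := h.edge_edge (k e) e' ((hψk e).trans he)
    rw [Function.comp_apply, Function.comp_apply, (hends e).1, (hends e).2, hq', hq'] at this
    exact ⟨Cell.vert.inj this.1, Cell.vert.inj this.2⟩
  · intro e'
    obtain ⟨e, he⟩ := h.surj_edge e'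
    rw [Function.comp_apply] at he
    cases hc : φ (edge e) with
    | vert x => rw [hc, hq'] at he; cases he
    | edge e'' => exact ⟨e'', hc ▸ he⟩
    | star => rw [hc, hstar] at he; cases he
  · intro e₁ e₂ e' h₁ h₂
    have := h.inj_edge ((hψk e₁).trans h₁) ((hψk e₂).trans h₂)
    have h' := hk e₁
    rw [this, hk e₂] at h'
    exact (Cell.edge.inj h').symm
  · -- the fibre of `ψ` is a contraction of the fibre of `ψ ∘ φ`
    obtain ⟨⟨⟨x₀⟩, hconn⟩, hgen⟩ := h.tree y
    refine ⟨⟨?_, ?_⟩, ?_⟩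
    · obtain ⟨z, hz⟩ := hφ.exists_vert x₀.1
      exact ⟨⟨z, (congrArg ψ hz).symm.trans x₀.2⟩⟩
    · have key : ∀ x x' : {x | (ψ ∘ φ) (vert x) = vert y},
          Relation.EqvGen (fun p q => ∃ e : {e | (ψ ∘ φ) (edge e) = vert y},
            (⟨P.s e, (h.edge_vert e y e.2).1⟩ : {x | (ψ ∘ φ) (vert x) = vert y}) = p ∧
            (⟨P.t e, (h.edge_vert e y e.2).2⟩ : {x | (ψ ∘ φ) (vert x) = vert y}) = q) x x' →
          ∀ z z' : {x | ψ (vert x) = vert y}, φ (vert x.1) = vert z.1 → φ (vert x'.1) = vert z'.1 →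
          Relation.EqvGen (fun p q => ∃ e : {e | ψ (edge e) = vert y},
            (⟨Q.s e, (H e e.2).1⟩ : {x | ψ (vert x) = vert y}) = p ∧
            (⟨Q.t e, (H e e.2).2⟩ : {x | ψ (vert x) = vert y}) = q) z z' := by
        intro x x' hxx
        induction hxx with
        | rel x x' hxx =>
          obtain ⟨⟨e, he⟩, rfl, rfl⟩ := hxx
          intro z z' hz hz'
          have he' : ψ (φ (edge e)) = vert y := he
          cases hc : φ (edge e) with
          | vert w =>
            have := hφ.edge_vert e w hc
            obtain rfl : z = z' := Subtype.ext
              ((Cell.vert.inj (hz.symm.trans this.1)).trans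
                (Cell.vert.inj (hz'.symm.trans this.2)).symm)
            exact .refl _
          | edge e' =>
            have := hφ.edge_edge e e' hc
            exact .rel _ _ ⟨⟨e', (congrArg ψ hc).symm.trans he'⟩,
              Subtype.ext (Cell.vert.inj (this.1.symm.trans hz)),
              Subtype.ext (Cell.vert.inj (this.2.symm.trans hz'))⟩
          | star => rw [hc, hstar] at he'; cases he'
        | refl x =>
          intro z z' hz hz'
          obtain rfl : z = z' := Subtype.ext (Cell.vert.inj (hz.symm.trans hz'))
          exact .refl _
        | symm x x' _ ih => intro z z' hz hz'; exact .symm _ _ (ih z' z hz' hz)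
        | trans x x' x'' _ _ ih₁ ih₂ =>
          intro z z'' hz hz''
          obtain ⟨w, hw⟩ := hφ.exists_vert x'.1
          have hw' : ψ (vert w) = vert y := hw ▸ x'.2
          exact .trans _ ⟨w, hw'⟩ _ (ih₁ z ⟨w, hw'⟩ hz hw) (ih₂ ⟨w, hw'⟩ z'' hw hz'')
      intro z z'
      have hz : ∀ z : {x | ψ (vert x) = vert y}, (ψ ∘ φ) (vert (f z.1)) = vert y := fun z => by
        rw [Function.comp_apply, hf]
        exact z.2
      exact key ⟨f z.1, hz z⟩ ⟨f z'.1, hz z'⟩ (hconn _ _) z z' (hf _) (hf _)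
    · classical
      rw [genus_eq_zero_iff]
      intro c
      let c' : P.E → ℚ := fun e =>
        if h : ∃ e', φ (edge e) = edge e' ∧ ψ (edge e') = vert y then c ⟨h.choose, h.choose_spec.2⟩
        else 0
      have hc'v : ∀ e x, φ (edge e) = vert x → c' e = 0 := by
        intro e x he
        refine dif_neg ?_
        rintro ⟨e', he', -⟩
        rw [he] at he'
        cases he'
      have hc'e : ∀ (e : P.E) (e' : {e | ψ (edge e) = vert y}), φ (edge e) = edge e'.1 →
          c' e = c e' := by
        intro e e' he
        have hex : ∃ e', φ (edge e) = edge e' ∧ ψ (edge e') = vert y := ⟨e'.1, he, e'.2⟩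
        simp only [c', dif_pos hex]
        congr 1
        exact Subtype.ext (Cell.edge.inj (hex.choose_spec.1.symm.trans he))
      obtain ⟨p, hp⟩ := (genus_eq_zero_iff _).1 hgen fun e => c' e.1
      have hp' : ∀ (e : P.E) (he : (ψ ∘ φ) (edge e) = vert y),
          p ⟨P.t e, (h.edge_vert e y he).2⟩ - p ⟨P.s e, (h.edge_vert e y he).1⟩ = c' e :=
        fun e he => hp ⟨e, he⟩
      -- the potential `p` is constant on the fibres of `φ`
      have hconst : ∀ (w : Q.V) (hw : ψ (vert w) = vert y) (x x' : {x | φ (vert x) = vert w}),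
          Relation.EqvGen (fun p q => ∃ e : {e | φ (edge e) = vert w},
            (⟨P.s e, (hφ.edge_vert e w e.2).1⟩ : {x | φ (vert x) = vert w}) = p ∧
            (⟨P.t e, (hφ.edge_vert e w e.2).2⟩ : {x | φ (vert x) = vert w}) = q) x x' →
          p ⟨x.1, (congrArg ψ x.2).trans hw⟩ = p ⟨x'.1, (congrArg ψ x'.2).trans hw⟩ := by
        intro w hw x x' hxx
        induction hxx with
        | rel x x' hxx =>
          obtain ⟨⟨e, he⟩, rfl, rfl⟩ := hxx
          have := hp' e ((congrArg ψ he).trans hw)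
          rw [hc'v e w he, sub_eq_zero] at this
          exact this.symm
        | refl x => rfl
        | symm x x' _ ih => exact ih.symm
        | trans x x' x'' _ _ ih₁ ih₂ => exact ih₁.trans ih₂
      have hfy : ∀ z, ψ (vert z) = vert y → (ψ ∘ φ) (vert (f z)) = vert y := fun z hz =>
        (congrArg ψ (hf z)).trans hz
      refine ⟨fun z => p ⟨f z.1, hfy z.1 z.2⟩, ?_⟩
      rintro ⟨e, he⟩
      have he' : (ψ ∘ φ) (edge (k e)) = vert y := (hψk e).trans he
      rw [← hc'e (k e) ⟨e, he⟩ (hk e), ← hp' (k e) he']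
      congr 1
      · exact hconst (Q.t e) (H e he).2 ⟨_, hf _⟩ ⟨_, (hends e).2⟩ ((hφ.tree _).1.2 _ _)
      · exact hconst (Q.s e) (H e he).1 ⟨_, hf _⟩ ⟨_, (hends e).1⟩ ((hφ.tree _).1.2 _ _)

end FinQuiver

/-! ### Base minor morphisms of directed cones -/

namespace DirectedCone

/-- The conditions on the types of the images of the cells that are common to base contractions and
base deletions. -/
structure IsBaseMap {C D : DirectedCone} (φ : Cell C.quiver → Cell D.quiver) : Prop where
  conePoint : φ (vert none) = vert none
  baseVertex : ∀ x : C.base.V, ∃ y : D.base.V, φ (vert (some x)) = vert (some y)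
  baseEdge : ∀ e : C.base.E, φ (edge (Sum.inl e)) = Cell.star ∨
    (∃ y : D.base.V, φ (edge (Sum.inl e)) = vert (some y)) ∨
    ∃ e' : D.base.E, φ (edge (Sum.inl e)) = edge (Sum.inl e')
  coneEdge : ∀ x : C.base.V, φ (edge (Sum.inr x)) = Cell.star ∨
    ∃ y : D.base.V, φ (edge (Sum.inr x)) = edge (Sum.inr y)

theorem IsBaseMinor.isBaseMap {C D : DirectedCone} {φ : C.quiver ⟶ D.quiver}
    (h : IsBaseMinor φ) : IsBaseMap φ.1 := by
  induction h with
  | contraction φ h => exact ⟨h.conePoint, h.baseVertex, fun e => .inr (h.baseEdge e), h.coneEdge⟩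
  | deletion φ h =>
    exact ⟨h.conePoint, h.baseVertex, fun e => (h.baseEdge e).imp_right .inr,
      fun x => .inr (h.coneEdge x)⟩
  | comp φ ψ _ _ hφ hψ =>
    have hstar := ψ.2.map_star
    refine ⟨?_, fun x => ?_, fun e => ?_, fun x => ?_⟩
    · change ψ.1 (φ.1 _) = _
      rw [hφ.conePoint, hψ.conePoint]
    · change ∃ y, ψ.1 (φ.1 _) = _
      obtain ⟨y, hy⟩ := hφ.baseVertex x
      rw [hy]
      exact hψ.baseVertex y
    · change ψ.1 (φ.1 _) = _ ∨ (∃ y, ψ.1 (φ.1 _) = _) ∨ ∃ y, ψ.1 (φ.1 _) = _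
      rcases hφ.baseEdge e with h | ⟨y, h⟩ | ⟨e', h⟩ <;> rw [h]
      · exact .inl hstar
      · exact .inr (.inl (hψ.baseVertex y))
      · exact hψ.baseEdge e'
    · change ψ.1 (φ.1 _) = _ ∨ ∃ y, ψ.1 (φ.1 _) = _
      rcases hφ.coneEdge x with h | ⟨y, h⟩ <;> rw [h]
      · exact .inl hstar
      · exact hψ.coneEdge y

/-- After removing the base edges that a minor morphism deletes, the base is still connected. -/
theorem connected_keep {C D : DirectedCone} {φ : Cell C.quiver → Cell D.quiver} (h : IsMinor φ)
    (hφ : IsBaseMap φ) : (C.base.keep {e | φ (edge (Sum.inl e)) ≠ Cell.star}).Connected := by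
  set R : C.base.V → C.base.V → Prop := Relation.EqvGen fun p q =>
    ∃ e : {e | φ (edge (Sum.inl e)) ≠ Cell.star}, C.base.s e.1 = p ∧ C.base.t e.1 = q with hR
  have key : ∀ y y' : D.base.V,
      Relation.EqvGen (fun p q => ∃ e : D.base.E, D.base.s e = p ∧ D.base.t e = q) y y' →
      ∀ x x', φ (vert (some x)) = vert (some y) → φ (vert (some x')) = vert (some y') →
        R x x' := by
    have fib : ∀ y x x', φ (vert (some x)) = vert (some y) →
        φ (vert (some x')) = vert (some y) → R x x' := by
      intro y x x' hx hx'
      have gen : ∀ p q : {x | φ (vert x) = vert (some y)},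
          Relation.EqvGen (fun p q => ∃ e : {e | φ (edge e) = vert (some y)},
            (⟨C.quiver.s e, (h.edge_vert e _ e.2).1⟩ : {x | φ (vert x) = vert (some y)}) = p ∧
            (⟨C.quiver.t e, (h.edge_vert e _ e.2).2⟩ : {x | φ (vert x) = vert (some y)}) = q) p q →
          ∀ p' q', p.1 = some p' → q.1 = some q' → R p' q' := by
        intro p q hpq
        induction hpq with
        | rel p q hpq =>
          obtain ⟨⟨e | x, he⟩, rfl, rfl⟩ := hpq
          · intro p' q' hp hq
            obtain rfl := Option.some.inj hp
            obtain rfl := Option.some.inj hq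
            refine .rel _ _ ⟨⟨e, fun h => ?_⟩, rfl, rfl⟩
            cases h.symm.trans he
          · rcases hφ.coneEdge x with h | ⟨z, h⟩
            · cases h.symm.trans he
            · cases h.symm.trans he
        | refl p =>
          intro p' q' hp hq
          obtain rfl := Option.some.inj (hp.symm.trans hq)
          exact .refl _
        | symm p q _ ih => intro p' q' hp hq; exact .symm _ _ (ih q' p' hq hp)
        | trans p q r _ _ ih₁ ih₂ =>
          intro p' r' hp hr
          obtain ⟨q, hq⟩ := q
          cases q with
          | none => cases hφ.conePoint.symm.trans hq
          | some q' => exact .trans _ q' _ (ih₁ p' q' hp rfl) (ih₂ q' r' rfl hr)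
      exact gen ⟨some x, hx⟩ ⟨some x', hx'⟩ ((h.tree _).1.2 _ _) x x' rfl rfl
    intro y y' hyy
    induction hyy with
    | rel y y' hyy =>
      obtain ⟨e', rfl, rfl⟩ := hyy
      intro x x' hx hx'
      obtain ⟨e | z, he⟩ := h.surj_edge (Sum.inl e' : D.base.E ⊕ D.base.V)
      · have := h.edge_edge _ _ he
        exact (fib _ x _ hx this.1).trans _ _ _ <| .trans _ _ _
          (.rel _ _ ⟨⟨e, fun h => by cases h.symm.trans he⟩, rfl, rfl⟩)
          (fib _ _ x' this.2 hx')
      · rcases hφ.coneEdge z with h | ⟨w, h⟩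
        · cases h.symm.trans he
        · cases h.symm.trans he
    | refl y => exact fib y
    | symm y y' _ ih => intro x x' hx hx'; exact .symm _ _ (ih x' x hx' hx)
    | trans p q r _ _ ih₁ ih₂ =>
      intro x x' hx hx'
      obtain ⟨w | w, hw⟩ := h.surj_vert (some q)
      · cases hφ.conePoint.symm.trans hw
      · exact .trans _ w _ (ih₁ x w hx hw) (ih₂ w x' hw hx')
  refine ⟨C.connected.1, fun x x' => ?_⟩
  obtain ⟨y, hy⟩ := hφ.baseVertex x
  obtain ⟨y', hy'⟩ := hφ.baseVertex x'
  exact key y y' (D.connected.2 y y') x x' hy hy'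

/-- A minor morphism deletes at most as many base edges as the genus of the base. -/
theorem card_deleted_le {C D : DirectedCone} {φ : Cell C.quiver → Cell D.quiver} (h : IsMinor φ)
    (hφ : IsBaseMap φ) : Nat.card {e | φ (edge (Sum.inl e)) = Cell.star} ≤ C.base.genus := by
  classical
  have := C.base.finite_E
  have h₁ := (connected_keep h hφ).genus_add_card
  have h₂ := C.connected.genus_add_card
  have h₃ := Nat.card_congr (Equiv.Set.sumCompl {e | φ (edge (Sum.inl e)) = Cell.star})
  rw [Nat.card_sum] at h₃
  change _ + Nat.card C.base.V = Nat.card ↥{e | φ (edge (Sum.inl e)) = Cell.star}ᶜ + 1 at h₁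
  omega

/-- The minor morphisms which are composed of base contractions and base deletions are recognized
by the types of the images of the cells: the deletions can be performed first. -/
theorem IsBaseMap.isBaseMinor {C D : DirectedCone} {φ : C.quiver ⟶ D.quiver}
    (hφ : IsBaseMap φ.1) : IsBaseMinor φ := by
  classical
  let C' : DirectedCone := ⟨_, connected_keep φ.2 hφ, C.up⟩
  let χ : Cell C.quiver → Cell C'.quiver := fun c =>
    match c with
    | vert x => vert x
    | edge (Sum.inl e) =>
      if h : φ.1 (edge (Sum.inl e)) ≠ Cell.star then edge (Sum.inl ⟨e, h⟩) else Cell.star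
    | edge (Sum.inr x) => edge (Sum.inr x)
    | .star => Cell.star
  have χpos : ∀ (e) (h : φ.1 (edge (Sum.inl e)) ≠ Cell.star),
      χ (edge (Sum.inl e)) = edge (Sum.inl ⟨e, h⟩) := fun e h => dif_pos h
  have χneg : ∀ e, φ.1 (edge (Sum.inl e)) = Cell.star → χ (edge (Sum.inl e)) = Cell.star :=
    fun e h => dif_neg (not_not.2 h)
  have χinl : ∀ e, (∃ h, χ (edge (Sum.inl e)) = edge (Sum.inl ⟨e, h⟩)) ∨
      φ.1 (edge (Sum.inl e)) = Cell.star ∧ χ (edge (Sum.inl e)) = Cell.star := by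
    intro e
    by_cases h : φ.1 (edge (Sum.inl e)) = Cell.star
    · exact .inr ⟨h, χneg e h⟩
    · exact .inl ⟨h, χpos e h⟩
  have hχ : IsMinor χ := by
    refine isMinor_of_bijective id (fun _ => rfl) rfl Function.bijective_id ?_ ?_ ?_ ?_
    · rintro (e | x) y h
      · rcases χinl e with ⟨_, h'⟩ | ⟨_, h'⟩ <;> cases h'.symm.trans h
      · cases h
    · rintro (e | x) e' h
      · rcases χinl e with ⟨_, h'⟩ | ⟨_, h'⟩ <;> cases h'.symm.trans h
        exact ⟨rfl, rfl⟩
      · cases h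
        exact ⟨rfl, rfl⟩
    · rintro (⟨e, he⟩ | x)
      · exact ⟨Sum.inl e, χpos e he⟩
      · exact ⟨Sum.inr x, rfl⟩
    · rintro (e₁ | x₁) (e₂ | x₂) e' h₁ h₂
      · rcases χinl e₁ with ⟨_, h'⟩ | ⟨_, h'⟩ <;> cases h'.symm.trans h₁
        rcases χinl e₂ with ⟨_, h'⟩ | ⟨_, h'⟩ <;> cases h'.symm.trans h₂
        rfl
      · rcases χinl e₁ with ⟨_, h'⟩ | ⟨_, h'⟩ <;> cases h'.symm.trans h₁
        cases h₂
      · rcases χinl e₂ with ⟨_, h'⟩ | ⟨_, h'⟩ <;> cases h'.symm.trans h₂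
        cases h₁
      · cases h₁
        cases h₂
        rfl
  let ψ : Cell C'.quiver → Cell D.quiver := fun c =>
    match c with
    | vert x => φ.1 (vert x)
    | edge (Sum.inl e) => φ.1 (edge (Sum.inl e.1))
    | edge (Sum.inr x) => φ.1 (edge (Sum.inr x))
    | .star => Cell.star
  have hcomp : ψ ∘ χ = φ.1 := by
    funext c
    rcases c with x | (e | x) | _
    · rfl
    · rcases χinl e with ⟨_, h'⟩ | ⟨h, h'⟩
      · simp only [Function.comp_apply, h', ψ]
      · simp only [Function.comp_apply, h', ψ, h]
    · rfl
    · exact φ.2.map_star.symm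
  have hψ : IsMinor ψ := hχ.of_comp (hcomp ▸ φ.2)
  let χ' : C.quiver ⟶ C'.quiver := ⟨χ, hχ⟩
  let ψ' : C'.quiver ⟶ D.quiver := ⟨ψ, hψ⟩
  have hφ' : φ = χ' ≫ ψ' := Subtype.ext hcomp.symm
  rw [hφ']
  refine .comp _ _ (.deletion _ ⟨rfl, fun x => ⟨x, rfl⟩, fun e => ?_, fun x => ⟨x, rfl⟩⟩)
    (.contraction _ ⟨hφ.conePoint, hφ.baseVertex, fun e => ?_, hφ.coneEdge⟩)
  · rcases χinl e with ⟨_, h'⟩ | ⟨h, h'⟩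
    · exact .inr ⟨_, h'⟩
    · exact .inl h'
  · exact (hφ.baseEdge e.1).resolve_left e.2

/-- The map of cells induced by maps of base vertices and base edges. -/
def mapCell {C D : DirectedCone} (f : C.base.V → D.base.V) (k : C.base.E → D.base.E) :
    Cell C.quiver → Cell D.quiver
  | vert x => vert (x.map f)
  | edge (Sum.inl e) => edge (Sum.inl (k e))
  | edge (Sum.inr x) => edge (Sum.inr (f x))
  | .star => Cell.star

/-- The isomorphism of directed cones induced by an isomorphism of bases. -/
def isoOfEquiv {C D : DirectedCone} (f : C.base.V ≃ D.base.V) (k : C.base.E ≃ D.base.E)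
    (hs : ∀ e, D.base.s (k e) = f (C.base.s e)) (ht : ∀ e, D.base.t (k e) = f (C.base.t e))
    (hup : ∀ x, D.up (f x) = C.up x) : C ≅ D :=
  have minor : ∀ {C D : DirectedCone} (f : C.base.V ≃ D.base.V) (k : C.base.E ≃ D.base.E)
    (_ : ∀ e, D.base.s (k e) = f (C.base.s e)) (_ : ∀ e, D.base.t (k e) = f (C.base.t e))
    (_ : ∀ x, D.up (f x) = C.up x), IsMinor (mapCell f k) := by
    intro C D f k hs ht hup
    refine isMinor_of_bijective (Option.map f) (fun _ => rfl) rfl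
      (Equiv.optionCongr f).bijective ?_ ?_ ?_ ?_
    · rintro (e | x) y h <;> cases h
    · rintro (e | x) _ ⟨⟩
      · exact ⟨congrArg some (hs e).symm, congrArg some (ht e).symm⟩
      · simp only [quiver, Sum.elim_inr, hup]
        constructor <;> split_ifs <;> rfl
    · rintro (e | x)
      · exact ⟨Sum.inl (k.symm e), by simp [mapCell]⟩
      · exact ⟨Sum.inr (f.symm x), by simp [mapCell]⟩
    · rintro (e₁ | x₁) (e₂ | x₂) e' ⟨⟩ h
      · rw [k.injective (Sum.inl.inj (Cell.edge.inj h))]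
      · cases h
      · cases h
      · rw [f.injective (Sum.inr.inj (Cell.edge.inj h))]
  have del : ∀ {C D : DirectedCone} (f : C.base.V ≃ D.base.V) (k : C.base.E ≃ D.base.E)
    (h : IsMinor (mapCell f k)), IsBaseMinor (⟨mapCell f k, h⟩ : C.quiver ⟶ D.quiver) :=
    fun f k h => .deletion _
      ⟨rfl, fun x => ⟨f x, rfl⟩, fun e => .inr ⟨k e, rfl⟩, fun x => ⟨f x, rfl⟩⟩
  { hom := ⟨_, del f k (minor f k hs ht hup)⟩
    inv := ⟨_, del f.symm k.symm (minor f.symm k.symm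
      (fun e => by rw [Equiv.eq_symm_apply, ← hs, k.apply_symm_apply])
      (fun e => by rw [Equiv.eq_symm_apply, ← ht, k.apply_symm_apply])
      (fun x => by rw [← hup, f.apply_symm_apply]))⟩
    hom_inv_id := by
      apply Subtype.ext
      apply Subtype.ext
      funext c
      change mapCell f.symm k.symm (mapCell f k c) = c
      rcases c with (_ | x) | (e | x) | _ <;> simp [mapCell]
    inv_hom_id := by
      apply Subtype.ext
      apply Subtype.ext
      funext c
      change mapCell f k (mapCell f.symm k.symm c) = c
      rcases c with (_ | x) | (e | x) | _ <;> simp [mapCell] }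

end DirectedCone

/-! ### Kruskal's theorem for binary trees and planar forests -/

section Kruskal

variable {Λ : Type*}

/-- Homeomorphic embedding of binary trees whose nodes carry labels. -/
inductive BinaryTree.Emb : BinaryTree Λ → BinaryTree Λ → Prop
  | nil (t) : Emb .nil t
  | left (a) {t l} (r) : Emb t l → Emb t (.node a l r)
  | right (a) {t} (l) {r} : Emb t r → Emb t (.node a l r)
  | node (a) {l r l' r'} : Emb l l' → Emb r r' → Emb (.node a l r) (.node a l' r')

open BinaryTree

theorem BinaryTree.Emb.refl (t : BinaryTree Λ) : Emb t t := by
  induction t with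
  | nil => exact .nil _
  | node a l r hl hr => exact .node a hl hr

theorem BinaryTree.Emb.trans {x y z : BinaryTree Λ} (h : Emb x y) (h' : Emb y z) : Emb x z := by
  induction h' generalizing x with
  | nil t => cases h; exact .nil _
  | left a r _ ih => exact .left _ _ (ih h)
  | right a l _ ih => exact .right _ _ (ih h)
  | node a _ _ ihl ihr =>
    cases h with
    | nil => exact .nil _
    | left _ _ h => exact .left _ _ (ihl h)
    | right _ _ h => exact .right _ _ (ihr h)
    | node _ h₁ h₂ => exact .node _ (ihl h₁) (ihr h₂)

instance : IsPreorder (BinaryTree Λ) BinaryTree.Emb where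
  refl := Emb.refl
  trans _ _ _ := Emb.trans

/-- **Kruskal's theorem** for binary trees with finitely many labels. -/
theorem BinaryTree.wellQuasiOrdered_emb [Finite Λ] :
    WellQuasiOrdered (Emb : BinaryTree Λ → BinaryTree Λ → Prop) := by
  rw [← Set.partiallyWellOrderedOn_univ_iff,
    Set.PartiallyWellOrderedOn.iff_not_exists_isMinBadSeq BinaryTree.numNodes]
  rintro ⟨f, hbad, hmin⟩
  have hnode : ∀ n, ∃ (a : Λ) (l r : BinaryTree Λ), f n = .node a l r := by
    intro n
    cases h : f n with
    | nil => exact absurd (h ▸ Emb.nil _) (hbad.2 n (n + 1) n.lt_succ_self)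
    | node a l r => exact ⟨a, l, r, rfl⟩
  choose a l r hf using hnode
  -- by minimality, the children of the terms of the sequence are well-quasi-ordered
  have hsub : ∀ (h : ℕ → BinaryTree Λ) (i : ℕ → ℕ), (∀ k, h k = l (i k) ∨ h k = r (i k)) →
      ∃ m n, m < n ∧ Emb (h m) (h n) := by
    intro h i hi
    by_contra! hh
    obtain ⟨k₀, hk₀⟩ : ∃ k₀, ∀ k, i k₀ ≤ i k := by
      obtain ⟨_, ⟨k₀, rfl⟩, hk₀⟩ := wellFounded_lt.has_min (Set.range i) ⟨_, 0, rfl⟩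
      exact ⟨k₀, fun k => not_lt.1 (hk₀ _ ⟨k, rfl⟩)⟩
    refine hmin (i k₀) (fun m => if m < i k₀ then f m else h (k₀ + (m - i k₀)))
      (fun m hm => (if_pos hm).symm) ?_ ⟨fun _ => trivial, fun m n hmn => ?_⟩
    · simp only [lt_irrefl, if_false, tsub_self, add_zero, hf (i k₀), numNodes]
      rcases hi k₀ with h | h <;> rw [h] <;> omega
    · dsimp only
      split_ifs with h₁ h₂ h₂
      · exact hbad.2 m n hmn
      · intro hE
        refine hbad.2 m (i (k₀ + (n - i k₀))) (h₁.trans_le (hk₀ _)) ?_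
        rw [hf (i (k₀ + (n - i k₀)))]
        rcases hi (k₀ + (n - i k₀)) with h' | h' <;> rw [h'] at hE
        · exact .left _ _ hE
        · exact .right _ _ hE
      · omega
      · exact hh _ _ (by omega)
  let s : Set (BinaryTree Λ) := {t | ∃ n, t = l n ∨ t = r n}
  have hs : WellQuasiOrdered fun x y : s => Emb x.1 y.1 := fun h => by
    choose i hi using fun k => (h k).2
    exact hsub (fun k => (h k).1) i hi
  have : IsPreorder s fun x y : s => Emb x.1 y.1 :=
    { refl := fun _ => Emb.refl _, trans := fun _ _ _ => Emb.trans }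
  obtain ⟨m, n, hmn, hl, hr, hΛ⟩ :=
    hs.prod (hs.prod (Finite.wellQuasiOrdered (Eq : Λ → Λ → Prop)))
      fun n => (⟨l n, n, .inl rfl⟩, ⟨r n, n, .inr rfl⟩, a n)
  refine hbad.2 m n hmn ?_
  rw [hf m, hf n, show a m = a n from hΛ]
  exact .node _ hl hr

/-- The binary tree `t` encodes the planar forest on the finite set `S` of vertices with ancestor
relation `anc`, ordered by depth-first traversal: the left child of a node is its first child in
the forest, and the right child is its next sibling. -/
inductive BinaryTree.Encodes {α : Type*} [LinearOrder α] (anc : α → α → Prop) (label : α → Λ) :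
    BinaryTree Λ → Finset α → Prop
  | nil : Encodes anc label .nil ∅
  | node (x : α) (S S₁ S₂ : Finset α) {a : Λ} {l r : BinaryTree Λ} (label_eq : label x = a)
      (mem_iff : ∀ y, y ∈ S ↔ y = x ∨ y ∈ S₁ ∨ y ∈ S₂)
      (desc : ∀ y ∈ S₁, x < y ∧ anc x y) (after : ∀ y ∈ S₂, x < y ∧ ¬ anc x y)
      (lt : ∀ y ∈ S₁, ∀ z ∈ S₂, y < z ∧ ¬ anc y z) :
      Encodes anc label l S₁ → Encodes anc label r S₂ → Encodes anc label (.node a l r) S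

theorem BinaryTree.exists_encodes {α : Type*} [LinearOrder α] {anc : α → α → Prop}
    (label : α → Λ) (trans : ∀ {u v w}, anc u v → anc v w → anc u w)
    (between : ∀ {u v w}, anc u w → u ≤ v → v ≤ w → anc u v) (S : Finset α) :
    ∃ t, Encodes anc label t S := by
  classical
  induction S using Finset.strongInduction with
  | H S ih =>
    rcases S.eq_empty_or_nonempty with rfl | hS
    · exact ⟨_, .nil⟩
    · set x := S.min' hS
      have hx : x ∈ S := S.min'_mem hS
      have hlt : ∀ y ∈ S.erase x, x < y := fun y hy =>
        lt_of_le_of_ne (S.min'_le y (Finset.mem_of_mem_erase hy)) (Finset.ne_of_mem_erase hy).symm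
      have hsub : ∀ (p : α → Prop) [DecidablePred p], (S.erase x).filter p ⊂ S := fun p _ =>
        (Finset.filter_subset _ _).trans_ssubset (Finset.erase_ssubset hx)
      obtain ⟨l, hl⟩ := ih _ (hsub (anc x))
      obtain ⟨r, hr⟩ := ih _ (hsub fun y => ¬ anc x y)
      refine ⟨_, .node x S _ _ rfl ?_ ?_ ?_ ?_ hl hr⟩
      · intro y
        simp only [Finset.mem_filter, Finset.mem_erase]
        by_cases h : y = x
        · simp [h, hx]
        · simp only [h, false_or, ne_eq, not_false_eq_true, true_and]
          tauto
      · intro y hy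
        obtain ⟨hy, hy'⟩ := Finset.mem_filter.1 hy
        exact ⟨hlt y hy, hy'⟩
      · intro y hy
        obtain ⟨hy, hy'⟩ := Finset.mem_filter.1 hy
        exact ⟨hlt y hy, hy'⟩
      · intro y hy z hz
        obtain ⟨hy, hy'⟩ := Finset.mem_filter.1 hy
        obtain ⟨hz, hz'⟩ := Finset.mem_filter.1 hz
        refine ⟨?_, fun h => hz' (trans hy' h)⟩
        by_contra! h
        exact hz' (between hy' (hlt z hz).le h)

/-- An embedding of binary trees induces an embedding of the encoded planar forests. -/
theorem BinaryTree.Emb.exists_map {α β : Type*} [LinearOrder α] [LinearOrder β] [Nonempty β]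
    {anc : α → α → Prop} {anc' : β → β → Prop} {label : α → Λ} {label' : β → Λ}
    (refl : ∀ u, anc u u) (refl' : ∀ u, anc' u u)
    (le : ∀ {u v}, anc u v → u ≤ v) (le' : ∀ {u v}, anc' u v → u ≤ v)
    {t t' : BinaryTree Λ} (h : Emb t t') {S : Finset α} {S' : Finset β}
    (ht : Encodes anc label t S) (ht' : Encodes anc' label' t' S') :
    ∃ f : α → β, ∀ u ∈ S, f u ∈ S' ∧ label' (f u) = label u ∧
      ∀ v ∈ S, (u < v → f u < f v) ∧ (anc u v ↔ anc' (f u) (f v)) := by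
  classical
  induction h generalizing S S' with
  | nil =>
    cases ht
    exact ⟨fun _ => Classical.arbitrary β, by simp⟩
  | left a r _ ih =>
    cases ht' with
    | node x' _ S₁' S₂' hx' mem' desc' after' lt' hl' hr' =>
      obtain ⟨f, hf⟩ := ih ht hl'
      exact ⟨f, fun u hu => ⟨(mem' _).2 (.inr (.inl (hf u hu).1)), (hf u hu).2⟩⟩
  | right a l _ ih =>
    cases ht' with
    | node x' _ S₁' S₂' hx' mem' desc' after' lt' hl' hr' =>
      obtain ⟨f, hf⟩ := ih ht hr'
      exact ⟨f, fun u hu => ⟨(mem' _).2 (.inr (.inr (hf u hu).1)), (hf u hu).2⟩⟩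
  | node a _ _ ihl ihr =>
    cases ht with
    | node x _ S₁ S₂ hx mem desc after lt hl hr =>
    cases ht' with
    | node x' _ S₁' S₂' hx' mem' desc' after' lt' hl' hr' =>
      obtain ⟨f₁, hf₁⟩ := ihl hl hl'
      obtain ⟨f₂, hf₂⟩ := ihr hr hr'
      let f : α → β := fun u => if u = x then x' else if u ∈ S₁ then f₁ u else f₂ u
      have fx : f x = x' := if_pos rfl
      have f1 : ∀ u ∈ S₁, f u = f₁ u := fun u hu => by
        simp only [f, if_neg (desc u hu).1.ne', if_pos hu]
      have f2 : ∀ u ∈ S₂, f u = f₂ u := fun u hu => by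
        simp only [f, if_neg (after u hu).1.ne', if_neg fun h => (lt u h u hu).1.false]
      have back : ∀ {u v}, u < v → ¬ anc v u := fun h h' => (le h').not_gt h
      have back' : ∀ {u v}, u < v → ¬ anc' v u := fun h h' => (le' h').not_gt h
      refine ⟨f, fun u hu => ?_⟩
      rcases (mem u).1 hu with rfl | hu | hu
      · rw [fx]
        refine ⟨(mem' _).2 (.inl rfl), hx'.trans hx.symm, fun v hv => ?_⟩
        rcases (mem v).1 hv with rfl | hv | hv
        · exact ⟨fun h => absurd h (lt_irrefl _), by simp only [fx, refl, refl']⟩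
        · rw [f1 v hv]
          have h := desc v hv
          have h' := desc' _ (hf₁ v hv).1
          exact ⟨fun _ => h'.1, iff_of_true h.2 h'.2⟩
        · rw [f2 v hv]
          have h := after v hv
          have h' := after' _ (hf₂ v hv).1
          exact ⟨fun _ => h'.1, iff_of_false h.2 h'.2⟩
      · rw [f1 u hu]
        refine ⟨(mem' _).2 (.inr (.inl (hf₁ u hu).1)), (hf₁ u hu).2.1, fun v hv => ?_⟩
        rcases (mem v).1 hv with rfl | hv | hv
        · rw [fx]
          have h := (desc u hu).1
          have h' := (desc' _ (hf₁ u hu).1).1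
          exact ⟨fun H => absurd H h.not_gt, iff_of_false (back h) (back' h')⟩
        · rw [f1 v hv]
          exact (hf₁ u hu).2.2 v hv
        · rw [f2 v hv]
          have h := lt u hu v hv
          have h' := lt' _ (hf₁ u hu).1 _ (hf₂ v hv).1
          exact ⟨fun _ => h'.1, iff_of_false h.2 h'.2⟩
      · rw [f2 u hu]
        refine ⟨(mem' _).2 (.inr (.inr (hf₂ u hu).1)), (hf₂ u hu).2.1, fun v hv => ?_⟩
        rcases (mem v).1 hv with rfl | hv | hv
        · rw [fx]
          have h := (after u hu).1
          have h' := (after' _ (hf₂ u hu).1).1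
          exact ⟨fun H => absurd H h.not_gt, iff_of_false (back h) (back' h')⟩
        · rw [f1 v hv]
          have h := (lt v hv u hu).1
          have h' := (lt' _ (hf₁ v hv).1 _ (hf₂ u hu).1).1
          exact ⟨fun H => absurd H h.not_gt, iff_of_false (back h) (back' h')⟩
        · rw [f2 v hv]
          exact (hf₂ u hu).2.2 v hv

end Kruskal

/-! ### Planar rooted trees -/

/-- A planar rooted tree with vertices `0, …, n`, numbered by depth-first traversal and encoded by
the relation `anc u v`, "`u` is `v` or an ancestor of `v`". Compatibility of the numbering with
the planar structure says that the descendants of a vertex form an interval. -/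
structure PlanarTree (n : ℕ) where
  /-- the (reflexive) ancestor relation -/
  anc : Fin (n + 1) → Fin (n + 1) → Prop
  refl : ∀ u, anc u u
  trans : ∀ {u v w}, anc u v → anc v w → anc u w
  le : ∀ {u v}, anc u v → u ≤ v
  between : ∀ {u v w}, anc u w → u ≤ v → v ≤ w → anc u v
  zero : ∀ v, anc 0 v

namespace PlanarTree

variable {n m : ℕ} (T : PlanarTree n)

theorem antisymm {u v : Fin (n + 1)} (h : T.anc u v) (h' : T.anc v u) : u = v :=
  le_antisymm (T.le h) (T.le h')

theorem eq_of_forall_anc_iff {u v : Fin (n + 1)} (h : ∀ w, T.anc w u ↔ T.anc w v) : u = v :=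
  T.antisymm ((h u).1 (T.refl u)) ((h v).2 (T.refl v))

/-- A nonempty chain of vertices that is closed under ancestors has a lowest element. -/
theorem exists_lowest {P : Fin (n + 1) → Prop} (h₀ : P 0)
    (hc : ∀ {u w}, P u → P w → u ≤ w → T.anc u w) (hP : ∀ {u w}, T.anc u w → P w → P u) :
    ∃ p, ∀ u, T.anc u p ↔ P u := by
  classical
  have hne : (Finset.univ.filter P).Nonempty := ⟨0, by simpa using h₀⟩
  have hp : P ((Finset.univ.filter P).max' hne) := by simpa using Finset.max'_mem _ hne
  exact ⟨_, fun u => ⟨fun h => hP h hp, fun h => hc h hp (Finset.le_max' _ _ (by simpa using h))⟩⟩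

theorem exists_parent {v : Fin (n + 1)} (hv : v ≠ 0) :
    ∃ p, ∀ u, T.anc u p ↔ T.anc u v ∧ u ≠ v := by
  refine T.exists_lowest ⟨T.zero v, hv.symm⟩ (fun h h' hle => T.between h.1 hle (T.le h'.1)) ?_
  rintro u w huw ⟨hw, hwv⟩
  exact ⟨T.trans huw hw, fun h => hwv (T.antisymm hw (h ▸ huw))⟩

open Classical in
/-- The parent of a vertex; the parent of the root is the root, a junk value. -/
noncomputable def parent (v : Fin (n + 1)) : Fin (n + 1) :=
  if h : v ≠ 0 then (T.exists_parent h).choose else 0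

theorem anc_parent_iff {u v : Fin (n + 1)} (hv : v ≠ 0) :
    T.anc u (T.parent v) ↔ T.anc u v ∧ u ≠ v := by
  rw [parent, dif_pos hv]
  exact (T.exists_parent hv).choose_spec u

theorem parent_lt {v : Fin (n + 1)} (hv : v ≠ 0) : T.parent v < v := by
  have h := (T.anc_parent_iff hv).1 (T.refl _)
  exact lt_of_le_of_ne (T.le h.1) h.2

theorem parent_eq {v p : Fin (n + 1)} (hv : v ≠ 0) (hp : ∀ u, T.anc u p ↔ T.anc u v ∧ u ≠ v) :
    T.parent v = p :=
  T.eq_of_forall_anc_iff fun u => (T.anc_parent_iff hv).trans (hp u).symm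

/-- An embedding of planar rooted trees: a map of vertices which preserves the root and the
depth-first order, and which preserves and reflects the ancestor relation. -/
structure Embedding (T : PlanarTree n) (U : PlanarTree m) where
  /-- the map of vertices -/
  toFun : Fin (n + 1) → Fin (m + 1)
  strictMono : StrictMono toFun
  anc_iff : ∀ {u v}, U.anc (toFun u) (toFun v) ↔ T.anc u v
  map_zero : toFun 0 = 0

namespace Embedding

variable {T} {k : ℕ} {U : PlanarTree m} {W : PlanarTree k}

instance : FunLike (Embedding T U) (Fin (n + 1)) (Fin (m + 1)) where
  coe f := f.toFun
  coe_injective f g h := by cases f; cases g; congr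

@[simp] theorem zero_apply (f : Embedding T U) : f 0 = 0 := f.map_zero

theorem anc_apply (f : Embedding T U) {u v : Fin (n + 1)} : U.anc (f u) (f v) ↔ T.anc u v :=
  f.anc_iff

theorem injective (f : Embedding T U) : Function.Injective f := f.strictMono.injective

theorem apply_eq_zero (f : Embedding T U) {u : Fin (n + 1)} : f u = 0 ↔ u = 0 :=
  ⟨fun h => f.injective (h.trans f.map_zero.symm), fun h => h ▸ f.map_zero⟩

/-- The identity embedding. -/
def id (T : PlanarTree n) : Embedding T T := ⟨_root_.id, strictMono_id, Iff.rfl, rfl⟩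

/-- Composition of embeddings, in diagrammatic order. -/
def comp (f : Embedding T U) (g : Embedding U W) : Embedding T W where
  toFun u := g (f u)
  strictMono := g.strictMono.comp f.strictMono
  anc_iff := g.anc_apply.trans f.anc_apply
  map_zero := by simp

@[simp] theorem comp_apply (f : Embedding T U) (g : Embedding U W) (u : Fin (n + 1)) :
    f.comp g u = g (f u) := rfl

theorem exists_proj (f : Embedding T U) (v : Fin (m + 1)) :
    ∃ p, ∀ u, T.anc u p ↔ U.anc (f u) v :=
  T.exists_lowest (by simp [U.zero])
    (fun h h' hle => f.anc_apply.1 (U.between h (f.strictMono.monotone hle) (U.le h')))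
    (fun h h' => U.trans (f.anc_apply.2 h) h')

/-- The contraction of trees which is right adjoint to the embedding `f`: it sends `v` to the
lowest vertex whose image under `f` is an ancestor of `v`. -/
noncomputable def proj (f : Embedding T U) (v : Fin (m + 1)) : Fin (n + 1) :=
  (f.exists_proj v).choose

theorem anc_proj_iff (f : Embedding T U) {u : Fin (n + 1)} {v : Fin (m + 1)} :
    T.anc u (f.proj v) ↔ U.anc (f u) v :=
  (f.exists_proj v).choose_spec u

@[simp] theorem proj_apply (f : Embedding T U) (u : Fin (n + 1)) : f.proj (f u) = u :=
  T.eq_of_forall_anc_iff fun _ => f.anc_proj_iff.trans f.anc_apply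

@[simp] theorem proj_zero (f : Embedding T U) : f.proj 0 = 0 := by simpa using f.proj_apply 0

theorem comp_proj (f : Embedding T U) (g : Embedding U W) (v : Fin (k + 1)) :
    (f.comp g).proj v = f.proj (g.proj v) :=
  T.eq_of_forall_anc_iff fun w => by simp only [anc_proj_iff, comp_apply]

/-- Edges of the tree above vertices outside the image of `f` are contracted. -/
theorem proj_parent (f : Embedding T U) {v : Fin (m + 1)} (hv : v ≠ 0) (h : f (f.proj v) ≠ v) :
    f.proj (U.parent v) = f.proj v :=
  T.eq_of_forall_anc_iff fun w => by
    rw [anc_proj_iff, anc_proj_iff, U.anc_parent_iff hv, and_iff_left_iff_imp]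
    rintro - rfl
    exact h (by simp)

theorem proj_parent_apply (f : Embedding T U) {u : Fin (n + 1)} (hu : u ≠ 0) :
    f.proj (U.parent (f u)) = T.parent u :=
  T.eq_of_forall_anc_iff fun w => by
    rw [anc_proj_iff, U.anc_parent_iff (f.apply_eq_zero.not.2 hu), T.anc_parent_iff hu,
      f.anc_apply, f.injective.ne_iff]

end Embedding

/-- The tree induced on a set of vertices which contains the root. -/
def comap (T : PlanarTree n) (f : Fin (m + 1) → Fin (n + 1)) (hf : StrictMono f) (h0 : f 0 = 0) :
    PlanarTree m where
  anc u v := T.anc (f u) (f v)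
  refl _ := T.refl _
  trans := T.trans
  le h := hf.le_iff_le.1 (T.le h)
  between h h' h'' := T.between h (hf.monotone h') (hf.monotone h'')
  zero v := by
    rw [h0]
    exact T.zero _

end PlanarTree

/-! ### Cones over quivers with a planar spanning tree -/

/-- A directed cone over a quiver of genus at most `g` with a planar rooted spanning tree of the
base. The spanning tree has one edge for each vertex other than the root, which joins the vertex to
its parent; the remaining edges of the base are numbered by the elements of a subset of `Fin g`. -/
structure TreeCone (g : ℕ) : Type 1 where
  /-- the number of edges of the spanning tree -/
  n : ℕ
  /-- the spanning tree -/
  tree : PlanarTree n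
  /-- the directions of the cone edges, as in `DirectedCone` -/
  up : Fin (n + 1) → Bool
  /-- `toParent v` holds if the tree edge above `v` goes from `v` to its parent; the value at the
  root is irrelevant -/
  toParent : Fin (n + 1) → Bool
  /-- the edges outside the spanning tree -/
  extra : Finset (Fin g)
  /-- sources of the edges outside the spanning tree; irrelevant outside `extra` -/
  src : Fin g → Fin (n + 1)
  /-- targets of the edges outside the spanning tree; irrelevant outside `extra` -/
  tgt : Fin g → Fin (n + 1)

namespace TreeCone

variable {g : ℕ}

/-- Morphisms are the embeddings of spanning trees which preserve the remaining data. -/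
@[ext]
structure Hom (c d : TreeCone g) where
  /-- the embedding of spanning trees -/
  emb : c.tree.Embedding d.tree
  up : ∀ u, d.up (emb u) = c.up u
  toParent : ∀ u, d.toParent (emb u) = c.toParent u
  extra : c.extra = d.extra
  src : ∀ i, emb (c.src i) = d.src i
  tgt : ∀ i, emb (c.tgt i) = d.tgt i

instance : Category (TreeCone g) where
  Hom := Hom
  id c := ⟨.id _, fun _ => rfl, fun _ => rfl, rfl, fun _ => rfl, fun _ => rfl⟩
  comp f h := ⟨f.emb.comp h.emb, fun u => (h.up _).trans (f.up u),
    fun u => (h.toParent _).trans (f.toParent u), f.extra.trans h.extra,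
    fun i => (congrArg h.emb (f.src i)).trans (h.src i),
    fun i => (congrArg h.emb (f.tgt i)).trans (h.tgt i)⟩

theorem hom_ext {c d : TreeCone g} {f h : c ⟶ d} (H : ∀ u, f.emb u = h.emb u) : f = h :=
  Hom.ext (DFunLike.ext _ _ H)

/-- Lexicographic comparison of embeddings makes the functors `Hom(c, -)` orderable. -/
theorem isOrderable (c : TreeCone g) : IsOrderable (coyoneda.obj (Opposite.op c)) := by
  refine ⟨fun d => InvImage (· < ·) fun f : c ⟶ d => toLex fun u => f.emb u, fun d => ?_, ?_⟩
  · have hinj : Function.Injective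
        (fun f : c ⟶ d => (toLex fun u => f.emb u : Lex (Fin (c.n + 1) → Fin (d.n + 1)))) :=
      fun f h H => hom_ext fun u => congrFun (toLex_inj.1 H) u
    have : IsWellOrder (Lex (Fin (c.n + 1) → Fin (d.n + 1))) (· < ·) := inferInstance
    exact (⟨⟨_, hinj⟩, Iff.rfl⟩ : InvImage (· < ·) (fun f : c ⟶ d =>
      (toLex fun u => f.emb u : Lex (Fin (c.n + 1) → Fin (d.n + 1)))) ↪r (· < ·)).isWellOrder
  · rintro d e h f f' ⟨i, hlt, hi⟩
    exact ⟨i, fun j hj => congrArg h.emb (hlt j hj), h.emb.strictMono hi⟩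

/-- The Noetherian property of `Hom(c, -)` is Kruskal's theorem: a map `f : c ⟶ d` is recorded in
the labels of the vertices of `d`. -/
theorem wellQuasiOrderedLE (c : TreeCone g) :
    WellQuasiOrderedLE (AssocPoset (coyoneda.obj (Opposite.op c))) := by
  classical
  refine ⟨fun F => ?_⟩
  obtain ⟨F, rfl⟩ : ∃ F' : ℕ → TotalSet (coyoneda.obj (Opposite.op c)),
      F = fun n => toAntisymmetrization (· ≤ ·) (F' n) :=
    ⟨fun n => ofAntisymmetrization _ (F n),
      funext fun n => (toAntisymmetrization_ofAntisymmetrization _ (F n)).symm⟩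
  let d : ℕ → TreeCone g := fun n => (F n).1
  let f : ∀ n, c ⟶ d n := fun n => (F n).2
  let label : ∀ n, Fin ((d n).n + 1) → Bool × Bool × Set (Fin (c.n + 1)) :=
    fun n v => ((d n).up v, (d n).toParent v, {u | (f n).emb u = v})
  choose t ht using fun n => BinaryTree.exists_encodes (anc := (d n).tree.anc) (label n)
    (d n).tree.trans (d n).tree.between Finset.univ
  obtain ⟨m, n, hmn, hE⟩ := BinaryTree.wellQuasiOrdered_emb t
  obtain ⟨φ, hφ⟩ := hE.exists_map (d m).tree.refl (d n).tree.refl (d m).tree.le (d n).tree.le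
    (ht m) (ht n)
  have hφ' := fun u => (hφ u (Finset.mem_univ _)).2
  have hf : ∀ u, φ ((f m).emb u) = (f n).emb u := by
    intro u
    have h : {w | (f n).emb w = φ ((f m).emb u)} = {w | (f m).emb w = (f m).emb u} :=
      congrArg (fun x => x.2.2) (hφ' ((f m).emb u)).1
    have : u ∈ {w | (f n).emb w = φ ((f m).emb u)} := by
      rw [h]
      rfl
    exact this.symm
  let h : d m ⟶ d n :=
    { emb :=
        { toFun := φ
          strictMono := fun u v huv => ((hφ' u).2 v (Finset.mem_univ _)).1 huv
          anc_iff := fun {u v} => ((hφ' u).2 v (Finset.mem_univ _)).2.symm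
          map_zero := by simpa using hf 0 }
      up := fun u => congrArg (fun x => x.1) (hφ' u).1
      toParent := fun u => congrArg (fun x => x.2.1) (hφ' u).1
      extra := (f m).extra.symm.trans (f n).extra
      src := fun i => by
        rw [← (f m).src, ← (f n).src]
        exact hf _
      tgt := fun i => by
        rw [← (f m).tgt, ← (f n).tgt]
        exact hf _ }
  exact ⟨m, n, hmn, toAntisymmetrization_le_toAntisymmetrization_iff.2 ⟨h, hom_ext hf⟩⟩

/-- The data of a tree cone on vertices `0, …, n`, apart from the laws of the spanning tree. -/
abbrev Data (g n : ℕ) : Type :=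
  (Fin (n + 1) → Fin (n + 1) → Prop) × (Fin (n + 1) → Bool) × (Fin (n + 1) → Bool) ×
    Finset (Fin g) × (Fin g → Fin (n + 1)) × (Fin g → Fin (n + 1))

/-- The data of a tree cone. -/
def toData (c : TreeCone g) : Σ n, Data g n :=
  ⟨c.n, c.tree.anc, c.up, c.toParent, c.extra, c.src, c.tgt⟩

theorem toData_injective : Function.Injective (toData (g := g)) := by
  rintro ⟨n, ⟨A, _⟩, _⟩ ⟨n', ⟨A', _⟩, _⟩ h
  obtain ⟨rfl, h⟩ := Sigma.mk.inj_iff.1 h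
  obtain ⟨rfl, rfl, rfl, rfl, rfl, rfl⟩ : _ ∧ _ ∧ _ ∧ _ ∧ _ ∧ _ := by
    simpa only [Prod.mk.injEq] using eq_of_heq h
  rfl

theorem finite_setOf_n_lt (N : ℕ) : {c : TreeCone g | c.n < N}.Finite := by
  let f : {c : TreeCone g | c.n < N} → Σ n : Fin N, Data g n :=
    fun c => ⟨⟨c.1.n, c.2⟩, (toData c.1).2⟩
  have hf : Function.Injective f := by
    intro c d h
    apply Subtype.ext
    apply toData_injective
    have : ∀ x : {c : TreeCone g | c.n < N},
        toData x.1 = (⟨(f x).1.1, (f x).2⟩ : Σ n, Data g n) := fun _ => rfl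
    rw [this, this, h]
  exact Set.finite_coe_iff.1 (Finite.of_injective f hf)

instance : EssentiallySmall.{0} (TreeCone g) := by
  have : Small.{0} (TreeCone g) := small_of_injective toData_injective
  exact essentiallySmall_of_small_of_locallySmall _

theorem isGrobner (g : ℕ) : IsGrobner (TreeCone g) :=
  ⟨inferInstance, fun c => ⟨c.isOrderable, c.wellQuasiOrderedLE⟩⟩

end TreeCone

/-! ### The cone of a tree cone, as a functor -/

namespace TreeCone

variable {g : ℕ}

/-- The base of the cone: the spanning tree together with the additional edges. -/
noncomputable def base (c : TreeCone g) : FinQuiver where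
  V := Fin (c.n + 1)
  E := {v : Fin (c.n + 1) // v ≠ 0} ⊕ {i // i ∈ c.extra}
  s := Sum.elim (fun v => if c.toParent v then v else c.tree.parent v) fun i => c.src i
  t := Sum.elim (fun v => if c.toParent v then c.tree.parent v else v) fun i => c.tgt i
  finite_V := inferInstance
  finite_E := inferInstance

theorem base_endpoints (c : TreeCone g) (v : {v : Fin (c.n + 1) // v ≠ 0}) :
    c.base.s (Sum.inl v) = v.1 ∧ c.base.t (Sum.inl v) = c.tree.parent v ∨
      c.base.s (Sum.inl v) = c.tree.parent v ∧ c.base.t (Sum.inl v) = v.1 := by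
  simp only [base, Sum.elim_inl]
  split_ifs
  · exact .inl ⟨rfl, rfl⟩
  · exact .inr ⟨rfl, rfl⟩

theorem base_connected (c : TreeCone g) : c.base.Connected :=
  connected_of_parent (0 : Fin (c.n + 1)) (fun v : Fin (c.n + 1) => (v : ℕ)) fun v hv =>
    ⟨Sum.inl ⟨v, hv⟩, c.tree.parent v, c.tree.parent_lt hv, c.base_endpoints ⟨v, hv⟩⟩

theorem card_base_E (c : TreeCone g) : Nat.card c.base.E = c.n + c.extra.card := by
  change Nat.card ({v : Fin (c.n + 1) // v ≠ 0} ⊕ {i // i ∈ c.extra}) = _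
  simp

theorem genus_base (c : TreeCone g) : c.base.genus = c.extra.card := by
  have h := c.base_connected.genus_add_card
  rw [card_base_E, show Nat.card c.base.V = c.n + 1 from Nat.card_fin _] at h
  omega

theorem genus_base_le (c : TreeCone g) : c.base.genus ≤ g := by
  rw [genus_base]
  exact (Finset.card_le_univ _).trans_eq (Fintype.card_fin g)

/-- The directed cone underlying a tree cone. -/
noncomputable def cone (c : TreeCone g) : DirectedCone := ⟨c.base, c.base_connected, c.up⟩

namespace Hom

variable {c d e : TreeCone g}

open Classical in
/-- The base contraction defined by an embedding of tree cones. Tree edges above vertices outside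
the image are contracted and the cone edges at these vertices are deleted. -/
noncomputable def mapCell (f : Hom c d) : Cell d.cone.quiver → Cell c.cone.quiver
  | vert x => vert (x.map f.emb.proj)
  | edge (Sum.inl (Sum.inl v)) =>
    if h : f.emb (f.emb.proj v) = v then
      edge (Sum.inl (Sum.inl ⟨f.emb.proj v, fun h' => v.2 (by rw [← h, h', f.emb.zero_apply])⟩))
    else vert (some (f.emb.proj v))
  | edge (Sum.inl (Sum.inr i)) => edge (Sum.inl (Sum.inr ⟨i.1, f.extra.ge i.2⟩))
  | edge (Sum.inr x) =>
    if f.emb (f.emb.proj x) = x then edge (Sum.inr (f.emb.proj x)) else Cell.star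
  | .star => Cell.star

/-- The inverse image of a cell that is not a vertex under the base contraction defined by an
embedding; on vertices, a section of the base contraction. -/
noncomputable def liftCell (f : Hom c d) : Cell c.cone.quiver → Cell d.cone.quiver
  | vert x => vert (x.map f.emb)
  | edge (Sum.inl (Sum.inl v)) => edge (Sum.inl (Sum.inl ⟨f.emb v, f.emb.apply_eq_zero.not.2 v.2⟩))
  | edge (Sum.inl (Sum.inr i)) => edge (Sum.inl (Sum.inr ⟨i.1, f.extra.le i.2⟩))
  | edge (Sum.inr x) => edge (Sum.inr (f.emb x))
  | .star => Cell.star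

theorem mapCell_liftCell (f : Hom c d) (x : Cell c.cone.quiver) :
    f.mapCell (f.liftCell x) = x := by
  rcases x with (_ | x) | ((v | i) | x) | _
  · rfl
  · exact congrArg (fun w : Fin (c.n + 1) => (vert (some w) : Cell c.cone.quiver))
      (f.emb.proj_apply x)
  · simp [mapCell, liftCell]
  · rfl
  · exact (if_pos (congrArg f.emb (f.emb.proj_apply x))).trans
      (congrArg (fun w : Fin (c.n + 1) => (edge (Sum.inr w) : Cell c.cone.quiver))
        (f.emb.proj_apply x))
  · rfl

theorem mapCell_tree (f : Hom c d) (v : {v : Fin (d.n + 1) // v ≠ 0}) :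
    (∃ u : {u : Fin (c.n + 1) // u ≠ 0}, f.emb u = v ∧
      f.mapCell (edge (Sum.inl (Sum.inl v))) = edge (Sum.inl (Sum.inl u))) ∨
    f.emb (f.emb.proj v) ≠ v ∧
      f.mapCell (edge (Sum.inl (Sum.inl v))) = vert (some (f.emb.proj v)) := by
  by_cases h : f.emb (f.emb.proj v) = v
  · exact .inl ⟨_, h, dif_pos h⟩
  · exact .inr ⟨h, dif_neg h⟩

theorem mapCell_cone (f : Hom c d) (x : Fin (d.n + 1)) :
    (∃ u, f.emb u = x ∧ f.mapCell (edge (Sum.inr x)) = edge (Sum.inr u)) ∨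
    f.emb (f.emb.proj x) ≠ x ∧ f.mapCell (edge (Sum.inr x)) = Cell.star := by
  by_cases h : f.emb (f.emb.proj x) = x
  · exact .inl ⟨_, h, if_pos h⟩
  · exact .inr ⟨h, if_neg h⟩

/-- An edge which is neither contracted nor deleted is the lift of its image. -/
theorem eq_liftCell (f : Hom c d) {e : d.cone.quiver.E} {e' : c.cone.quiver.E}
    (h : f.mapCell (edge e) = edge e') : edge e = f.liftCell (edge e') := by
  rcases e with (v | i) | x
  · rcases f.mapCell_tree v with ⟨u, hu, h'⟩ | ⟨_, h'⟩ <;> cases h'.symm.trans h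
    simp [liftCell, hu]
  · cases h
    rfl
  · rcases f.mapCell_cone x with ⟨u, rfl, h'⟩ | ⟨_, h'⟩ <;> cases h'.symm.trans h
    rfl

theorem isMinor_mapCell (f : Hom c d) : IsMinor f.mapCell := by
  refine isMinor_of (Option.map f.emb.proj) (fun _ => rfl) rfl ?_ ?_ ?_ ?_ ?_ ?_
  · rintro (_ | x)
    · exact ⟨none, rfl⟩
    · exact ⟨some (f.emb x), congrArg some (f.emb.proj_apply x)⟩
  · rintro ((v | i) | x) y h
    · rcases f.mapCell_tree v with ⟨u, _, h'⟩ | ⟨hv, h'⟩ <;> cases h'.symm.trans h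
      have hp := f.emb.proj_parent v.2 hv
      rcases d.base_endpoints v with ⟨hs, ht⟩ | ⟨hs, ht⟩
      · exact ⟨congrArg (fun x => some (f.emb.proj x)) hs,
          (congrArg (fun x => some (f.emb.proj x)) ht).trans (congrArg some hp)⟩
      · exact ⟨(congrArg (fun x => some (f.emb.proj x)) hs).trans (congrArg some hp),
          congrArg (fun x => some (f.emb.proj x)) ht⟩
    · cases h
    · rcases f.mapCell_cone x with ⟨u, _, h'⟩ | ⟨_, h'⟩ <;> cases h'.symm.trans h
  · rintro ((v | i) | x) e' h
    · rcases f.mapCell_tree v with ⟨u, hu, h'⟩ | ⟨hv, h'⟩ <;> cases h'.symm.trans h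
      have hp := f.emb.proj_parent_apply u.2
      obtain ⟨v, hv⟩ := v
      dsimp only at hu
      subst hu
      simp only [DirectedCone.quiver, cone, base, Sum.elim_inl, f.toParent, Option.map_some]
      split_ifs <;> simp [hp]
    · cases h
      simp only [DirectedCone.quiver, cone, base, Sum.elim_inl, Sum.elim_inr, Option.map_some,
        ← f.src, ← f.tgt, PlanarTree.Embedding.proj_apply, and_self]
    · rcases f.mapCell_cone x with ⟨u, hu, h'⟩ | ⟨_, h'⟩ <;> cases h'.symm.trans h
      subst hu
      change Option.map f.emb.proj (if d.up (f.emb u) then some (f.emb u) else none) =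
          (if c.up u then some u else none) ∧
        Option.map f.emb.proj (if d.up (f.emb u) then none else some (f.emb u)) =
          (if c.up u then none else some u)
      rw [f.up]
      split_ifs <;> simp
  · intro e'
    rcases e' with (v | i) | x
    exacts [⟨_, f.mapCell_liftCell (edge (Sum.inl (Sum.inl v)))⟩,
      ⟨_, f.mapCell_liftCell (edge (Sum.inl (Sum.inr i)))⟩,
      ⟨_, f.mapCell_liftCell (edge (Sum.inr x))⟩]
  · intro e₁ e₂ e' h₁ h₂
    exact Cell.edge.inj ((f.eq_liftCell h₁).trans (f.eq_liftCell h₂).symm)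
  · rintro (_ | y) H
    · refine Connected.isTree (connected_of_parent ⟨none, rfl⟩ (fun _ => 0) ?_) ?_
      · rintro ⟨_ | x, hx⟩ hne
        · exact absurd rfl hne
        · cases hx
      · have : IsEmpty (d.cone.quiver.sub _ _ H).E := by
          refine ⟨?_⟩
          rintro ⟨(v | i) | x, h⟩
          · rcases f.mapCell_tree v with ⟨u, _, h'⟩ | ⟨hv, h'⟩ <;> cases h'.symm.trans h
          · cases h
          · rcases f.mapCell_cone x with ⟨u, _, h'⟩ | ⟨_, h'⟩ <;> cases h'.symm.trans h
        have : Finite (d.cone.quiver.sub _ _ H).V := (d.cone.quiver.sub _ _ H).finite_V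
        have : Nonempty (d.cone.quiver.sub _ _ H).V := ⟨⟨none, rfl⟩⟩
        rw [Nat.card_of_isEmpty]
        exact Nat.card_pos
    · -- the fibre over `y` is the subtree on the vertices `v` with `proj v = y`, with root `f y`
      have hroot : f.mapCell (vert (some (f.emb y))) = vert (some y) :=
        congrArg (fun w : Fin (c.n + 1) => (vert (some w) : Cell c.cone.quiver))
          (f.emb.proj_apply y)
      have hne : ∀ (v : Fin (d.n + 1)), f.emb.proj v = y → v ≠ f.emb y →
          v ≠ 0 ∧ f.emb (f.emb.proj v) ≠ v := by
        rintro v rfl hv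
        refine ⟨?_, hv.symm⟩
        rintro rfl
        exact hv (by simp)
      have hedge : ∀ v : {v : Fin (d.n + 1) // v ≠ 0}, f.emb.proj v = y → v.1 ≠ f.emb y →
          f.mapCell (edge (Sum.inl (Sum.inl v))) = vert (some y) := by
        rintro v rfl hv
        exact dif_neg hv.symm
      refine Connected.isTree (connected_of_parent ⟨some (f.emb y), hroot⟩
        (fun x => x.1.elim 0 fun v : Fin (d.n + 1) => (v : ℕ)) ?_) ?_
      · rintro ⟨_ | v, hv⟩ hvne
        · cases hv
        · have hv' : f.emb.proj v = y := Option.some.inj (Cell.vert.inj hv)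
          have hvy : v ≠ f.emb y := fun h => hvne (Subtype.ext (congrArg some h))
          obtain ⟨h0, h⟩ := hne v hv' hvy
          refine ⟨⟨Sum.inl (Sum.inl ⟨v, h0⟩), hedge ⟨v, h0⟩ hv' hvy⟩,
            ⟨some (d.tree.parent v), ?_⟩, d.tree.parent_lt h0, ?_⟩
          · exact congrArg (fun w : Fin (c.n + 1) => (vert (some w) : Cell c.cone.quiver))
              ((f.emb.proj_parent h0 h).trans hv')
          · rcases d.base_endpoints ⟨v, h0⟩ with ⟨hs, ht⟩ | ⟨hs, ht⟩
            · exact .inl ⟨Subtype.ext (congrArg some hs), Subtype.ext (congrArg some ht)⟩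
            · exact .inr ⟨Subtype.ext (congrArg some hs), Subtype.ext (congrArg some ht)⟩
      · have : Finite (d.cone.quiver.sub _ _ H).V := (d.cone.quiver.sub _ _ H).finite_V
        have : Finite (d.cone.quiver.sub _ _ H).E := (d.cone.quiver.sub _ _ H).finite_E
        rw [← Finite.card_option]
        have hE : ∀ e : (d.cone.quiver.sub _ _ H).E, ∃ v : {v : Fin (d.n + 1) // v ≠ 0},
            e.1 = Sum.inl (Sum.inl v) ∧ f.emb.proj v = y ∧ v.1 ≠ f.emb y := by
          rintro ⟨(v | i) | x, h⟩
          · rcases f.mapCell_tree v with ⟨u, _, h'⟩ | ⟨hv, h'⟩ <;> cases h'.symm.trans h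
            exact ⟨v, rfl, rfl, hv.symm⟩
          · cases h
          · rcases f.mapCell_cone x with ⟨u, _, h'⟩ | ⟨_, h'⟩ <;> cases h'.symm.trans h
        choose v hv hvy hvne using hE
        refine Nat.card_le_card_of_injective (fun o => o.elim ⟨some (f.emb y), hroot⟩
          fun e => ⟨some (v e).1, congrArg (fun w : Fin (c.n + 1) =>
            (vert (some w) : Cell c.cone.quiver)) (hvy e)⟩) ?_
        rintro (_ | e₁) (_ | e₂) h
        · rfl
        · exact absurd (Option.some.inj (congrArg Subtype.val h)).symm (hvne e₂)
        · exact absurd (Option.some.inj (congrArg Subtype.val h)) (hvne e₁)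
        · have : v e₁ = v e₂ := Subtype.ext (Option.some.inj (congrArg Subtype.val h))
          exact congrArg some (Subtype.ext ((hv e₁).trans (this ▸ (hv e₂).symm)))

theorem isBaseContraction_mapCell (f : Hom c d) :
    DirectedCone.IsBaseContraction (⟨f.mapCell, f.isMinor_mapCell⟩ : d.cone.quiver ⟶ c.cone.quiver)
    where
  conePoint := rfl
  baseVertex x := ⟨_, rfl⟩
  baseEdge := by
    rintro (v | i)
    · rcases f.mapCell_tree v with ⟨u, _, h⟩ | ⟨_, h⟩
      · exact .inr ⟨_, h⟩
      · exact .inl ⟨_, h⟩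
    · exact .inr ⟨_, rfl⟩
  coneEdge x := by
    rcases f.mapCell_cone x with ⟨u, _, h⟩ | ⟨_, h⟩
    · exact .inr ⟨_, h⟩
    · exact .inl h

/-- The morphism of directed cones defined by an embedding of tree cones. -/
noncomputable def toCone (f : Hom c d) : d.cone ⟶ c.cone :=
  ⟨⟨f.mapCell, f.isMinor_mapCell⟩, .contraction _ f.isBaseContraction_mapCell⟩

end Hom

theorem mapCell_id (c : TreeCone g) : Hom.mapCell (𝟙 c) = id := by
  funext x
  have h : Hom.liftCell (𝟙 c) x = x := by
    rcases x with (_ | x) | ((v | i) | x) | _ <;> rfl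
  exact (congrArg _ h).symm.trans (Hom.mapCell_liftCell (𝟙 c) x)

theorem mapCell_comp {c d e : TreeCone g} (f : c ⟶ d) (h : d ⟶ e) :
    Hom.mapCell (f ≫ h) = Hom.mapCell f ∘ Hom.mapCell h := by
  funext x
  rw [Function.comp_apply]
  have hproj : ∀ v, (Hom.emb (f ≫ h)).proj v = f.emb.proj (h.emb.proj v) :=
    f.emb.comp_proj h.emb
  rcases x with (_ | x) | ((v | i) | x) | _
  · rfl
  · exact congrArg (fun w : Fin (c.n + 1) => (vert (some w) : Cell c.cone.quiver)) (hproj x)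
  · rcases h.mapCell_tree v with ⟨u, hu, hv⟩ | ⟨hu, hv⟩
    · rw [hv]
      rcases f.mapCell_tree u with ⟨w, hw, hu'⟩ | ⟨hw, hu'⟩ <;>
        refine Eq.trans ?_ hu'.symm
      · obtain rfl : v = ⟨(Hom.emb (f ≫ h)) w, (Hom.emb (f ≫ h)).apply_eq_zero.not.2 w.2⟩ :=
          Subtype.ext (hu.symm.trans (congrArg h.emb hw.symm))
        exact (f ≫ h).mapCell_liftCell (edge (Sum.inl (Sum.inl w)))
      · rcases (f ≫ h).mapCell_tree v with ⟨w, hw', hv'⟩ | ⟨_, hv'⟩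
        · have hwu : f.emb w = u := h.emb.injective (hw'.trans hu.symm)
          rw [← hwu] at hw
          exact absurd (congrArg f.emb (f.emb.proj_apply w)) hw
        · rw [hv', hproj, ← hu, h.emb.proj_apply]
    · rw [hv]
      rcases (f ≫ h).mapCell_tree v with ⟨w, hw', hv'⟩ | ⟨_, hv'⟩
      · refine absurd ?_ hu
        rw [← hw']
        exact congrArg h.emb (h.emb.proj_apply (f.emb w))
      · rw [hv', hproj]
        rfl
  · rfl
  · rcases h.mapCell_cone x with ⟨u, hu, hv⟩ | ⟨hu, hv⟩
    · rw [hv]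
      rcases f.mapCell_cone u with ⟨w, rfl, hu'⟩ | ⟨hw, hu'⟩ <;>
        refine Eq.trans ?_ hu'.symm
      · subst hu
        exact (f ≫ h).mapCell_liftCell (edge (Sum.inr w))
      · rcases (f ≫ h).mapCell_cone x with ⟨w, hw', hv'⟩ | ⟨_, hv'⟩
        · have hwu : f.emb w = u := h.emb.injective (hw'.trans hu.symm)
          rw [← hwu] at hw
          exact absurd (congrArg f.emb (f.emb.proj_apply w)) hw
        · exact hv'
    · rw [hv]
      rcases (f ≫ h).mapCell_cone x with ⟨w, hw', hv'⟩ | ⟨_, hv'⟩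
      · refine absurd ?_ hu
        rw [← hw']
        exact congrArg h.emb (h.emb.proj_apply (f.emb w))
      · exact hv'
  · rfl

/-- The directed cone underlying a tree cone, as a functor. -/
noncomputable def toConeQuiver (g : ℕ) : TreeCone g ⥤ (ConeQuiver g)ᵒᵖ where
  obj c := Opposite.op ⟨c.cone, c.genus_base_le⟩
  map f := Quiver.Hom.op (ObjectProperty.homMk f.toCone)
  map_id c := Quiver.Hom.unop_inj <| ObjectProperty.hom_ext _ <| Subtype.ext <| Subtype.ext <|
    c.mapCell_id
  map_comp f h := Quiver.Hom.unop_inj <| ObjectProperty.hom_ext _ <| Subtype.ext <| Subtype.ext <|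
    mapCell_comp f h

end TreeCone

/-! ### Spanning trees -/

namespace PlanarTree

variable {n : ℕ}

/-- The tree with one vertex. -/
def point : PlanarTree 0 where
  anc _ _ := True
  refl _ := trivial
  trans _ _ := trivial
  le {u v} _ := by omega
  between _ _ _ := trivial
  zero _ := trivial

theorem eq_succ_of_predAbove_eq {w : Fin (n + 1)} {u v : Fin (n + 2)}
    (h : w.predAbove u = w.predAbove v) (huv : v < u) : u = w.succ := by
  rcases lt_or_ge w.castSucc u with hu | hu <;> rcases lt_or_ge w.castSucc v with hv | hv
  · rw [Fin.predAbove_of_castSucc_lt _ _ hu, Fin.predAbove_of_castSucc_lt _ _ hv,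
      Fin.pred_inj] at h
    exact absurd h huv.ne'
  · rw [Fin.predAbove_of_castSucc_lt _ _ hu, Fin.predAbove_of_le_castSucc _ _ hv,
      Fin.ext_iff, Fin.val_pred, Fin.coe_castPred] at h
    rw [Fin.lt_def, Fin.val_castSucc] at hu
    rw [Fin.le_def, Fin.val_castSucc] at hv
    rw [Fin.ext_iff, Fin.val_succ]
    omega
  · exact absurd (huv.trans_le hu) hv.not_gt
  · rw [Fin.predAbove_of_le_castSucc _ _ hu, Fin.predAbove_of_le_castSucc _ _ hv,
      Fin.castPred_inj] at h
    exact absurd h huv.ne'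

theorem predAbove_succ_succAbove (w u : Fin (n + 1)) :
    w.predAbove (w.succ.succAbove u) = u :=
  Fin.succAbove_right_injective (Fin.succ_succAbove_predAbove (Fin.succAbove_ne _ _))

/-- The planar tree obtained by adding a new leaf as the first child of `w`. The new vertex is
`w.succ`. -/
def insertLeaf (T : PlanarTree n) (w : Fin (n + 1)) : PlanarTree (n + 1) where
  anc u v := u = v ∨ u ≠ w.succ ∧ T.anc (w.predAbove u) (w.predAbove v)
  refl u := .inl rfl
  trans := by
    rintro u v x (rfl | ⟨hu, huv⟩) (rfl | ⟨hv, hvx⟩)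
    · exact .inl rfl
    · exact .inr ⟨hv, hvx⟩
    · exact .inr ⟨hu, huv⟩
    · exact .inr ⟨hu, T.trans huv hvx⟩
  le := by
    rintro u v (rfl | ⟨hu, huv⟩)
    · exact le_rfl
    · by_contra! h
      exact hu (eq_succ_of_predAbove_eq
        ((T.le huv).antisymm (Fin.predAbove_right_monotone w h.le)) h)
  between := by
    rintro u v x (rfl | ⟨hu, hux⟩) huv hvx
    · exact .inl (huv.antisymm hvx)
    · exact .inr ⟨hu, T.between hux (Fin.predAbove_right_monotone w huv)
        (Fin.predAbove_right_monotone w hvx)⟩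
  zero v := by
    refine .inr ⟨(Fin.succ_ne_zero w).symm, ?_⟩
    rw [Fin.predAbove_right_zero]
    exact T.zero _

theorem insertLeaf_anc_succAbove (T : PlanarTree n) (w u v : Fin (n + 1)) :
    (T.insertLeaf w).anc (w.succ.succAbove u) (w.succ.succAbove v) ↔ T.anc u v := by
  simp only [insertLeaf, predAbove_succ_succAbove]
  refine ⟨?_, fun h => .inr ⟨Fin.succAbove_ne _ _, h⟩⟩
  rintro (h | h)
  · rw [Fin.succAbove_right_injective h]
    exact T.refl v
  · exact h.2

theorem insertLeaf_anc_succ (T : PlanarTree n) (w u : Fin (n + 1)) :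
    (T.insertLeaf w).anc (w.succ.succAbove u) w.succ ↔ T.anc u w := by
  simp only [insertLeaf, predAbove_succ_succAbove, Fin.predAbove_succ_self]
  exact ⟨fun h => (h.resolve_left (Fin.succAbove_ne _ _)).2,
    fun h => .inr ⟨Fin.succAbove_ne _ _, h⟩⟩

theorem insertLeaf_succ_anc (T : PlanarTree n) (w : Fin (n + 1)) (v : Fin (n + 2)) :
    (T.insertLeaf w).anc w.succ v ↔ w.succ = v := by
  simp [insertLeaf]

theorem insertLeaf_parent_succ (T : PlanarTree n) (w : Fin (n + 1)) :
    (T.insertLeaf w).parent w.succ = w.succ.succAbove w := by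
  refine parent_eq _ (Fin.succ_ne_zero w) fun u => ?_
  rcases Fin.eq_self_or_eq_succAbove w.succ u with rfl | ⟨u, rfl⟩
  · rw [insertLeaf_succ_anc]
    exact iff_of_false (Fin.succAbove_ne _ _).symm fun h => h.2 rfl
  · rw [insertLeaf_anc_succ, insertLeaf_anc_succAbove]
    exact (and_iff_left (Fin.succAbove_ne _ _)).symm

theorem succ_succAbove_eq_zero {w v : Fin (n + 1)} : w.succ.succAbove v = 0 ↔ v = 0 :=
  Fin.succAbove_eq_zero_iff (Fin.succ_ne_zero w)

theorem insertLeaf_parent_succAbove (T : PlanarTree n) (w : Fin (n + 1)) {v : Fin (n + 1)}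
    (hv : v ≠ 0) :
    (T.insertLeaf w).parent (w.succ.succAbove v) = w.succ.succAbove (T.parent v) := by
  refine parent_eq _ (fun h => hv (succ_succAbove_eq_zero.1 h)) fun u => ?_
  rcases Fin.eq_self_or_eq_succAbove w.succ u with rfl | ⟨u, rfl⟩
  · rw [insertLeaf_succ_anc, insertLeaf_succ_anc]
    exact iff_of_false (Fin.succAbove_ne _ _).symm fun h => Fin.succAbove_ne _ _ h.1.symm
  · rw [insertLeaf_anc_succAbove, insertLeaf_anc_succAbove, T.anc_parent_iff hv,
      (Fin.succAbove_right_injective).ne_iff]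

end PlanarTree

/-- The edge `e` joins `x` and `y`, in one of the two directions. -/
def FinQuiver.Joins (Q : FinQuiver) (e : Q.E) (x y : Q.V) : Prop :=
  Q.s e = x ∧ Q.t e = y ∨ Q.s e = y ∧ Q.t e = x

theorem FinQuiver.Joins.symm {Q : FinQuiver} {e : Q.E} {x y : Q.V} (h : Q.Joins e x y) :
    Q.Joins e y x :=
  Or.symm h

theorem FinQuiver.Connected.exists_joins {Q : FinQuiver} (hQ : Q.Connected) {X : Set Q.V}
    (hne : X.Nonempty) (huniv : X ≠ Set.univ) : ∃ e, ∃ x ∈ X, ∃ y ∉ X, Q.Joins e x y := by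
  by_contra! h
  obtain ⟨x, hx⟩ := hne
  obtain ⟨y, hy⟩ := (Set.ne_univ_iff_exists_notMem X).1 huniv
  have : ∀ p q, Relation.EqvGen (fun p q => ∃ e : Q.E, Q.s e = p ∧ Q.t e = q) p q →
      (p ∈ X ↔ q ∈ X) := by
    intro p q hpq
    induction hpq with
    | rel p q hpq =>
      obtain ⟨e, he⟩ := hpq
      by_contra hne
      by_cases hp : p ∈ X
      · exact h e p hp q (fun hq => hne (iff_of_true hp hq)) (.inl he)
      · exact h e q (by tauto) p hp (.inr he)
    | refl p => rfl
    | symm p q _ ih => exact ih.symm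
    | trans p q r _ _ ih₁ ih₂ => exact ih₁.trans ih₂
  exact hy ((this x y (hQ.2 x y)).1 hx)

/-- A planar rooted tree in a connected quiver can be grown, one leaf at a time, to any size up to
the number of vertices. -/
theorem FinQuiver.Connected.exists_planarTree {Q : FinQuiver} (hQ : Q.Connected) (k : ℕ)
    (hk : k + 1 ≤ Nat.card Q.V) : ∃ (T : PlanarTree k) (f : Fin (k + 1) → Q.V),
      Function.Injective f ∧ ∀ v, v ≠ 0 → ∃ e, Q.Joins e (f v) (f (T.parent v)) := by
  induction k with
  | zero =>
    obtain ⟨x⟩ := hQ.1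
    exact ⟨.point, fun _ => x, fun _ _ _ => by omega, fun v hv => absurd (by omega) hv⟩
  | succ k ih =>
    obtain ⟨T, f, hf, hT⟩ := ih (by omega)
    have huniv : Set.range f ≠ Set.univ := by
      intro h
      have := Nat.card_le_card_of_surjective f (Set.range_eq_univ.1 h)
      rw [Nat.card_fin] at this
      omega
    obtain ⟨e, _, ⟨w, rfl⟩, y, hy, he⟩ := hQ.exists_joins (Set.range_nonempty f) huniv
    refine ⟨T.insertLeaf w, w.succ.insertNth y f, ?_, fun v hv => ?_⟩
    · intro u v huv
      rcases Fin.eq_self_or_eq_succAbove w.succ u with rfl | ⟨u, rfl⟩ <;>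
        rcases Fin.eq_self_or_eq_succAbove w.succ v with rfl | ⟨v, rfl⟩ <;>
        simp only [Fin.insertNth_apply_same, Fin.insertNth_apply_succAbove] at huv
      · rfl
      · exact absurd ⟨v, huv.symm⟩ hy
      · exact absurd ⟨u, huv⟩ hy
      · rw [hf huv]
    · rcases Fin.eq_self_or_eq_succAbove w.succ v with rfl | ⟨v, rfl⟩
      · refine ⟨e, ?_⟩
        rw [T.insertLeaf_parent_succ, Fin.insertNth_apply_same, Fin.insertNth_apply_succAbove]
        exact he.symm
      · have hv' : v ≠ 0 := by
          rintro rfl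
          exact hv (PlanarTree.succ_succAbove_eq_zero.2 rfl)
        obtain ⟨e', he'⟩ := hT v hv'
        refine ⟨e', ?_⟩
        rwa [T.insertLeaf_parent_succAbove w hv', Fin.insertNth_apply_succAbove,
          Fin.insertNth_apply_succAbove]

namespace TreeCone

variable {g : ℕ}

/-! ### Essential surjectivity -/

/-- Every directed cone over a quiver of genus at most `g` has a planar spanning tree in its base,
and at most `g` edges lie outside of it. -/
theorem exists_iso (C : DirectedCone) (hC : C.base.genus ≤ g) :
    ∃ c : TreeCone g, Nonempty (c.cone ≅ C) := by
  classical
  have := C.base.finite_V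
  have := C.base.finite_E
  have hpos : 0 < Nat.card C.base.V := by
    have := C.connected.1
    exact Nat.card_pos
  obtain ⟨n, hn⟩ : ∃ n, n + 1 = Nat.card C.base.V := ⟨_, Nat.sub_add_cancel hpos⟩
  obtain ⟨T, f₀, hf₀, hT⟩ := C.connected.exists_planarTree n hn.le
  choose τ hτ using hT
  let f : Fin (n + 1) ≃ C.base.V := Equiv.ofBijective f₀
    ((Nat.bijective_iff_injective_and_card f₀).2 ⟨hf₀, by rw [Nat.card_fin, hn]⟩)
  -- edges of the spanning tree are distinct, as the parent of a vertex is a smaller vertex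
  have hτinj : Function.Injective fun v : {v : Fin (n + 1) // v ≠ 0} => τ v.1 v.2 := by
    rintro ⟨v, hv⟩ ⟨v', hv'⟩ h
    have h₁ := hτ v hv
    have h₂ := hτ v' hv'
    dsimp only at h
    rw [← h] at h₂
    apply Subtype.ext
    have l₁ := T.parent_lt hv
    have l₂ := T.parent_lt hv'
    rcases h₁ with ⟨a₁, b₁⟩ | ⟨a₁, b₁⟩ <;> rcases h₂ with ⟨a₂, b₂⟩ | ⟨a₂, b₂⟩
    · exact hf₀ (a₁.symm.trans a₂)
    · have e₁ := hf₀ (a₁.symm.trans a₂)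
      have e₂ := hf₀ (b₁.symm.trans b₂)
      rw [e₂, e₁] at l₁
      exact absurd l₁ l₂.not_gt
    · have e₁ := hf₀ (a₁.symm.trans a₂)
      have e₂ := hf₀ (b₁.symm.trans b₂)
      rw [e₁, e₂] at l₁
      exact absurd l₁ l₂.not_gt
    · exact hf₀ (b₁.symm.trans b₂)
  set X : Set C.base.E := Set.range fun v : {v : Fin (n + 1) // v ≠ 0} => τ v.1 v.2 with hX
  have hcard : Nat.card ↥Xᶜ ≤ Nat.card (Fin g) := by
    have h₁ := C.connected.genus_add_card
    have h₂ := Nat.card_congr (Equiv.Set.sumCompl X)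
    rw [Nat.card_sum, ← Nat.card_congr (Equiv.ofInjective _ hτinj)] at h₂
    have h₃ : Nat.card {v : Fin (n + 1) // v ≠ 0} = n := by simp
    rw [Nat.card_fin]
    omega
  obtain ⟨j⟩ : Nonempty (↥Xᶜ ↪ Fin g) := by
    have := Fintype.ofFinite ↥Xᶜ
    rw [Nat.card_eq_fintype_card, Nat.card_eq_fintype_card] at hcard
    exact Function.Embedding.nonempty_of_card_le hcard
  let c : TreeCone g :=
    { n := n
      tree := T
      up := fun v => C.up (f v)
      toParent := fun v => decide (∃ h : v ≠ 0, C.base.s (τ v h) = f v)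
      extra := Finset.univ.filter fun i => i ∈ Set.range j
      src := Function.extend j (fun e => f.symm (C.base.s e)) 0
      tgt := Function.extend j (fun e => f.symm (C.base.t e)) 0 }
  let k : c.base.E ≃ C.base.E :=
    (Equiv.sumCongr (Equiv.ofInjective _ hτinj)
      ((Equiv.subtypeEquivRight fun i => by simp [c]).trans
        (Equiv.ofInjective j j.injective).symm)).trans (Equiv.Set.sumCompl X)
  have hkl : ∀ v, k (Sum.inl v) = τ v.1 v.2 := fun v => rfl
  have hkr : ∀ i : {i // i ∈ c.extra}, ∃ e : ↥Xᶜ, i.1 = j e ∧ k (Sum.inr i) = e.1 := by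
    rintro ⟨i, hi⟩
    obtain ⟨e, rfl⟩ := (Finset.mem_filter.1 hi).2
    refine ⟨e, rfl, ?_⟩
    change (((Equiv.ofInjective j j.injective).symm ⟨j e, e, rfl⟩ : ↥Xᶜ) : C.base.E) = e
    rw [Equiv.ofInjective_symm_apply]
  refine ⟨c, ⟨DirectedCone.isoOfEquiv (C := c.cone) f k ?_ ?_ fun _ => rfl⟩⟩
  · rintro (v | i)
    · change C.base.s (k (Sum.inl v)) = f (if c.toParent v then v.1 else T.parent v)
      rw [hkl]
      by_cases h : C.base.s (τ v.1 v.2) = f v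
      · rw [if_pos (decide_eq_true ⟨v.2, h⟩), h]
      · rw [if_neg fun H => h (of_decide_eq_true H).2]
        exact ((hτ v.1 v.2).resolve_left fun H => h H.1).1
    · obtain ⟨e, he, hk⟩ := hkr i
      have h : c.src i.1 = f.symm (C.base.s e.1) := by
        rw [he]
        exact j.injective.extend_apply (fun e => f.symm (C.base.s e)) 0 e
      change C.base.s (k (Sum.inr i)) = f (c.src i.1)
      rw [hk, h, f.apply_symm_apply]
  · rintro (v | i)
    · have hne := (T.parent_lt v.2).ne
      change C.base.t (k (Sum.inl v)) = f (if c.toParent v then T.parent v else v.1)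
      rw [hkl]
      by_cases h : C.base.s (τ v.1 v.2) = f v
      · rw [if_pos (decide_eq_true ⟨v.2, h⟩)]
        exact ((hτ v.1 v.2).resolve_right fun H => hne (hf₀ (H.1.symm.trans h))).2
      · rw [if_neg fun H => h (of_decide_eq_true H).2]
        exact ((hτ v.1 v.2).resolve_left fun H => h H.1).2
    · obtain ⟨e, he, hk⟩ := hkr i
      have h : c.tgt i.1 = f.symm (C.base.t e.1) := by
        rw [he]
        exact j.injective.extend_apply (fun e => f.symm (C.base.t e)) 0 e
      change C.base.t (k (Sum.inr i)) = f (c.tgt i.1)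
      rw [hk, h, f.apply_symm_apply]

instance : (toConeQuiver g).EssSurj where
  mem_essImage C := by
    obtain ⟨c, ⟨e⟩⟩ := exists_iso C.unop.obj C.unop.property
    exact ⟨c, ⟨(ObjectProperty.isoMk _ e.symm : C.unop ≅ ⟨c.cone, c.genus_base_le⟩).op⟩⟩

/-! ### Property (F) -/

/-- The tree cone induced on a set of vertices which contains the root and the end points of the
additional edges. -/
theorem exists_hom_range_eq (c : TreeCone g) (W : Set (Fin (c.n + 1))) (h0 : 0 ∈ W)
    (hsrc : ∀ i, c.src i ∈ W) (htgt : ∀ i, c.tgt i ∈ W) :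
    ∃ (d : TreeCone g) (f : d ⟶ c), Set.range f.emb = W ∧ d.n + 1 = W.ncard := by
  classical
  have hpos : 0 < W.ncard := (Set.ncard_pos (Set.toFinite W)).2 ⟨0, h0⟩
  obtain ⟨m, hm⟩ : ∃ m, m + 1 = W.ncard := ⟨_, Nat.sub_add_cancel hpos⟩
  have hcard : W.toFinset.card = m + 1 := by rw [hm, Set.ncard_eq_toFinset_card']
  let f := W.toFinset.orderEmbOfFin hcard
  have hf : Set.range f = W := by simp [f]
  have hf0 : f 0 = 0 := by
    obtain ⟨u, hu⟩ : 0 ∈ Set.range f := hf ▸ h0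
    exact le_antisymm (hu ▸ f.monotone (Fin.zero_le u)) (Fin.zero_le _)
  choose s hs using fun i => (hf ▸ hsrc i : c.src i ∈ Set.range f)
  choose t ht using fun i => (hf ▸ htgt i : c.tgt i ∈ Set.range f)
  exact ⟨⟨m, c.tree.comap f f.strictMono hf0, fun u => c.up (f u), fun u => c.toParent (f u),
    c.extra, s, t⟩, ⟨⟨f, f.strictMono, Iff.rfl, hf0⟩, fun _ => rfl, fun _ => rfl, rfl, hs, ht⟩,
    hf, hm⟩

/-- A base minor morphism which contracts the tree edges and deletes the cone edges at all vertices
outside the image of an embedding factors through the base contraction of this embedding. -/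
theorem exists_factorization {c d : TreeCone g} (f : d ⟶ c) {D : DirectedCone} (φ : c.cone ⟶ D)
    (htree : ∀ v : {v : Fin (c.n + 1) // v ≠ 0}, v.1 ∉ Set.range f.emb →
      ∃ y, φ.1.1 (edge (Sum.inl (Sum.inl v))) = vert y)
    (hcone : ∀ x : Fin (c.n + 1), x ∉ Set.range f.emb →
      φ.1.1 (edge (Sum.inr x)) = Cell.star) :
    ∃ ψ : d.cone ⟶ D, φ = f.toCone ≫ ψ := by
  have hφ := φ.2.isBaseMap
  have hproj : ∀ n (v : Fin (c.n + 1)), (v : ℕ) = n →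
      φ.1.1 (vert (some (f.emb (f.emb.proj v)))) = φ.1.1 (vert (some v)) := by
    intro n
    induction n using Nat.strong_induction_on with
    | _ n ih =>
      rintro v rfl
      by_cases hv : f.emb (f.emb.proj v) = v
      · rw [hv]
      · have h0 : v ≠ 0 := by
          rintro rfl
          exact hv (by simp)
        have hr : v ∉ Set.range f.emb := by
          rintro ⟨u, rfl⟩
          exact hv (by rw [f.emb.proj_apply])
        obtain ⟨y, hy⟩ := htree ⟨v, h0⟩ hr
        have hst := φ.1.2.edge_vert _ _ hy
        have hpar : φ.1.1 (vert (some (c.tree.parent v))) = φ.1.1 (vert (some v)) := by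
          rcases c.base_endpoints ⟨v, h0⟩ with ⟨hs, ht⟩ | ⟨hs, ht⟩
          · have h₁ := congrArg (fun x => φ.1.1 (vert (some x))) hs
            have h₂ := congrArg (fun x => φ.1.1 (vert (some x))) ht
            exact h₂.symm.trans ((hst.2.trans hst.1.symm).trans h₁)
          · have h₁ := congrArg (fun x => φ.1.1 (vert (some x))) hs
            have h₂ := congrArg (fun x => φ.1.1 (vert (some x))) ht
            exact h₁.symm.trans ((hst.1.trans hst.2.symm).trans h₂)
        rw [← hpar, ← ih _ (c.tree.parent_lt h0) _ rfl, f.emb.proj_parent h0 hv]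
  have hcomp : (φ.1.1 ∘ Hom.liftCell f) ∘ Hom.mapCell f = φ.1.1 := by
    funext x
    rcases x with (_ | x) | ((v | i) | x) | _
    · rfl
    · exact hproj _ x rfl
    · rcases f.mapCell_tree v with ⟨u, hu, h⟩ | ⟨hu, h⟩
      · refine (congrArg (φ.1.1 ∘ Hom.liftCell f) h).trans ?_
        exact congrArg φ.1.1 (f.eq_liftCell h).symm
      · refine (congrArg (φ.1.1 ∘ Hom.liftCell f) h).trans ?_
        have hr : v.1 ∉ Set.range f.emb := by
          rintro ⟨u, hu'⟩
          exact hu (by rw [← hu', f.emb.proj_apply])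
        obtain ⟨y, hy⟩ := htree v hr
        have hst := φ.1.2.edge_vert _ _ hy
        refine (hproj _ v.1 rfl).trans (Eq.trans ?_ hy.symm)
        rcases c.base_endpoints v with ⟨hs, ht⟩ | ⟨hs, ht⟩
        · exact (congrArg (fun x => φ.1.1 (vert (some x))) hs).symm.trans hst.1
        · exact (congrArg (fun x => φ.1.1 (vert (some x))) ht).symm.trans hst.2
    · rfl
    · rcases f.mapCell_cone x with ⟨u, hu, h⟩ | ⟨hu, h⟩
      · refine (congrArg (φ.1.1 ∘ Hom.liftCell f) h).trans ?_
        exact congrArg φ.1.1 (f.eq_liftCell h).symm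
      · refine (congrArg (φ.1.1 ∘ Hom.liftCell f) h).trans ?_
        have hr : x ∉ Set.range f.emb := by
          rintro ⟨u, rfl⟩
          exact hu (by rw [f.emb.proj_apply])
        exact φ.1.2.map_star.trans (hcone x hr).symm
    · rfl
  have hψ : IsMinor (φ.1.1 ∘ Hom.liftCell f) := f.isMinor_mapCell.of_comp (hcomp.symm ▸ φ.1.2)
  have hψ' : DirectedCone.IsBaseMap (φ.1.1 ∘ Hom.liftCell f) := by
    refine ⟨hφ.conePoint, fun x => hφ.baseVertex _, ?_, fun x => hφ.coneEdge _⟩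
    rintro (v | i)
    · exact hφ.baseEdge _
    · exact hφ.baseEdge _
  let ψ : d.cone.quiver ⟶ D.quiver := ⟨_, hψ⟩
  exact ⟨⟨ψ, DirectedCone.IsBaseMap.isBaseMinor (φ := ψ) hψ'⟩,
    Subtype.ext (Subtype.ext hcomp.symm)⟩

/-- Every base minor morphism to `D` from the cone of a tree cone factors through a tree cone of
bounded size: contract the tree edges that are contracted, except for those above the vertices at
which the cone edge survives and those above the end points of the additional edges. -/
theorem exists_bounded_factorization {c : TreeCone g} {D : DirectedCone} (φ : c.cone ⟶ D) :
    ∃ (d : TreeCone g) (f : d ⟶ c) (ψ : d.cone ⟶ D), φ = f.toCone ≫ ψ ∧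
      d.n < 1 + Nat.card D.base.E + g + Nat.card D.base.V + g + g := by
  have := D.base.finite_V
  have := D.base.finite_E
  have : Finite c.cone.base.E := c.base.finite_E
  have hφ := φ.2.isBaseMap
  let X₁ : Set (Fin (c.n + 1)) := {v | ∃ (h : v ≠ 0) (e : D.base.E),
    φ.1.1 (edge (Sum.inl (Sum.inl ⟨v, h⟩))) = edge (Sum.inl e)}
  let X₂ : Set (Fin (c.n + 1)) := {v | ∃ h : v ≠ 0,
    φ.1.1 (edge (Sum.inl (Sum.inl ⟨v, h⟩))) = Cell.star}
  let X₃ : Set (Fin (c.n + 1)) := {x | ∃ y : D.base.V, φ.1.1 (edge (Sum.inr x)) = edge (Sum.inr y)}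
  have h₁ : X₁.ncard ≤ Nat.card D.base.E := by
    choose h e he using fun v : X₁ => v.2
    refine Nat.card_le_card_of_injective e fun v v' hvv => Subtype.ext ?_
    have := φ.1.2.inj_edge (he v) (hvv ▸ he v')
    have h' := Sum.inl.inj this
    have h'' := Sum.inl.inj h'
    exact Subtype.mk.inj h''
  have h₂ : X₂.ncard ≤ g := by
    refine le_trans ?_ ((DirectedCone.card_deleted_le φ.1.2 hφ).trans c.genus_base_le)
    choose h e using fun v : X₂ => v.2
    refine Nat.card_le_card_of_injective
      (fun v => (⟨Sum.inl ⟨v.1, h v⟩, e v⟩ :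
        {e : c.cone.base.E | φ.1.1 (edge (Sum.inl e)) = Cell.star})) fun v v' hvv => Subtype.ext ?_
    have h' := congrArg Subtype.val hvv
    dsimp only at h'
    have h'' := Sum.inl.inj h'
    exact Subtype.mk.inj h''
  have h₃ : X₃.ncard ≤ Nat.card D.base.V := by
    choose y hy using fun x : X₃ => x.2
    refine Nat.card_le_card_of_injective y fun x x' hxx => Subtype.ext ?_
    have := φ.1.2.inj_edge (hy x) (hxx ▸ hy x')
    exact Sum.inr.inj this
  have h₄ : (Set.range c.src).ncard ≤ g := (Finite.card_range_le _).trans_eq (Nat.card_fin g)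
  have h₅ : (Set.range c.tgt).ncard ≤ g := (Finite.card_range_le _).trans_eq (Nat.card_fin g)
  let W := ({0} ∪ X₁ ∪ X₂ ∪ X₃ ∪ Set.range c.src ∪ Set.range c.tgt)
  obtain ⟨d, f, hf, hd⟩ := c.exists_hom_range_eq W (by simp [W])
    (fun i => .inl (.inr ⟨i, rfl⟩)) (fun i => .inr ⟨i, rfl⟩)
  obtain ⟨ψ, hψ⟩ := exists_factorization f φ (fun v hv => by
    rw [hf] at hv
    rcases hφ.baseEdge (Sum.inl v) with h | ⟨y, h⟩ | ⟨e, h⟩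
    · exact absurd (.inl (.inl (.inl (.inr ⟨v.2, h⟩)))) hv
    · exact ⟨_, h⟩
    · exact absurd (.inl (.inl (.inl (.inl (.inr ⟨v.2, e, h⟩))))) hv) (fun x hx => by
    rw [hf] at hx
    rcases hφ.coneEdge x with h | ⟨y, h⟩
    · exact h
    · exact absurd (.inl (.inl (.inr ⟨y, h⟩))) hx)
  refine ⟨d, f, ψ, hψ, ?_⟩
  have u₁ := Set.ncard_union_le ({0} ∪ X₁ ∪ X₂ ∪ X₃ ∪ Set.range c.src) (Set.range c.tgt)
  have u₂ := Set.ncard_union_le ({0} ∪ X₁ ∪ X₂ ∪ X₃) (Set.range c.src)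
  have u₃ := Set.ncard_union_le ({0} ∪ X₁ ∪ X₂) X₃
  have u₄ := Set.ncard_union_le ({0} ∪ X₁) X₂
  have u₅ := Set.ncard_union_le {0} X₁
  rw [Set.ncard_singleton] at u₅
  simp only [W] at hd
  omega

end TreeCone

instance FinQuiver.finite_cell (Q : FinQuiver) : Finite (Cell Q) := by
  have := Q.finite_V
  have := Q.finite_E
  refine Finite.of_surjective (fun x : Option (Q.V ⊕ Q.E) =>
    x.elim Cell.star (Sum.elim vert edge)) ?_
  rintro (x | e | _)
  exacts [⟨some (Sum.inl x), rfl⟩, ⟨some (Sum.inr e), rfl⟩, ⟨none, rfl⟩]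

instance DirectedCone.finite_hom (C D : DirectedCone) : Finite (C ⟶ D) :=
  Finite.of_injective (fun φ : C ⟶ D => φ.1.1) fun _ _ h => Subtype.ext (Subtype.ext h)

theorem TreeCone.hasPropertyF (g : ℕ) : HasPropertyF (TreeCone.toConeQuiver g) := by
  intro D
  let N := 1 + Nat.card D.unop.obj.base.E + g + Nat.card D.unop.obj.base.V + g + g
  have := (TreeCone.finite_setOf_n_lt (g := g) N).to_subtype
  obtain ⟨n, ⟨e⟩⟩ := Finite.exists_equiv_fin
    (Σ c : {c : TreeCone g | c.n < N}, (c.1.cone ⟶ D.unop.obj))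
  refine ⟨n, fun i => (e.symm i).1.1, fun i => Quiver.Hom.op (ObjectProperty.homMk (e.symm i).2),
    fun c' δ => ?_⟩
  obtain ⟨d, f, ψ, hψ, hd⟩ := TreeCone.exists_bounded_factorization (c := c') δ.unop.hom
  obtain ⟨i, hi⟩ := e.symm.surjective ⟨⟨d, hd⟩, ψ⟩
  have key : ∀ x : Σ c : {c : TreeCone g | c.n < N}, (c.1.cone ⟶ D.unop.obj), x = ⟨⟨d, hd⟩, ψ⟩ →
      ∃ γ : x.1.1 ⟶ c', δ = Quiver.Hom.op (ObjectProperty.homMk x.2) ≫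
        (TreeCone.toConeQuiver g).map γ := by
    rintro _ rfl
    exact ⟨f, Quiver.Hom.unop_inj (ObjectProperty.hom_ext _ hψ)⟩
  exact ⟨i, key _ hi⟩

theorem isQuasiGrobner_coneQuiver_op (g : ℕ) : IsQuasiGrobner (ConeQuiver g)ᵒᵖ := by
  refine ⟨?_, TreeCone g, inferInstance, TreeCone.toConeQuiver g, TreeCone.isGrobner g,
    inferInstance, TreeCone.hasPropertyF g⟩
  rw [essentiallySmall_iff]
  refine ⟨?_, inferInstance⟩
  have : Small.{0} (TreeCone g) := small_of_injective TreeCone.toData_injective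
  refine small_of_surjective (f := fun c => toSkeleton ((TreeCone.toConeQuiver g).obj c)) fun C =>
    ⟨(TreeCone.toConeQuiver g).objPreimage ((fromSkeleton _).obj C),
      toSkeleton_eq_iff.2 ⟨(TreeCone.toConeQuiver g).objObjPreimageIso _⟩⟩

theorem mainTheorem8 (g : ℕ) :
    IsQuasiGrobner (ConeQuiver g)ᵒᵖ ∧
    ∀ (A : Type a) [Ring A] [IsNoetherianRing A] (M : (ConeQuiver g)ᵒᵖ ⥤ ModuleCat.{b} A),
      IsFinGenRep M → ∀ N : Subrep M, IsFinGenRep N.toRep :=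
  ⟨isQuasiGrobner_coneQuiver_op g, fun _ _ _ _ hM N =>
    (isQuasiGrobner_coneQuiver_op g).isFinGenRep_subrep hM N⟩
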